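/- Let $R$ be a commutative Noetherian local ring. For an ideal $\mathfrak a$ of $R$, let $H^i_{\mathfrak a}(M)$ denote the $i$-th local cohomology module of an $R$-module $M$ with respect to $\mathfrak a$, and let $\operatorname{id} M$ denote the injective dimension of $M$ over $R$ (with $\operatorname{id} 0=-\infty$). The ring $R$ is called Gorenstein if $\operatorname{id} R<\infty$. A finitely generated $R$-module $M$ is called relative Cohen–Macaulay with respect to $\mathfrak a$ if $H^i_{\mathfrak a}(M)\neq 0$ for precisely one integer $i\ge 0$. Let $\mathfrak a$ be a proper ideal of $R$ such that $R$ is relative Cohen–Macaulay with respect to $\mathfrak a$, and let $\operatorname{ht}_R\mathfrak a=\inf\{\dim R_{\mathfrak p} : \mathfrak p\in\operatorname{Spec}R,\ \mathfrak a\subseteq\mathfrak p\}$ be the height of $\mathfrak a$. Then $R$ is Gorenstein if and only if $\operatorname{id}H^{\operatorname{ht}_R\mathfrak a}_{\mathfrak a}(R)<\infty$. In particular, if $n\ge 0$ is an integer and $\mathbf x=x_1,\dots,x_n$ is an $R$-sequence (i.e. each $x_i$ is a non-zero-divisor on $R/(x_1,\dots,x_{i-1})$ and $(x_1,\dots,x_n)\neq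 R$), then $R$ is Gorenstein if and only if $\operatorname{id}H^n_{(\mathbf x)}(R)<\infty$. -/

import Mathlib

universe u

/-- The injective dimension `id_R M` of a module, with values in `WithBot ℕ∞`
(the zero module has injective dimension `⊥`, standing for `-∞`), is finite, i.e. `id_R M < ∞`. -/
def HasFiniteInjDim {R : Type u} [CommRing R] (M : ModuleCat.{u} R) : Prop :=
  CategoryTheory.injectiveDimension M < ⊤

/-- A Gorenstein local ring: a Noetherian local ring of finite injective dimension as a module
over itself. -/
structure IsGorensteinLocalRing (R : Type u) [CommRing R] : Prop where
  isLocalRing : IsLocalRing R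
  isNoetherianRing : IsNoetherianRing R
  hasFiniteInjDim : HasFiniteInjDim (ModuleCat.of R R)

/-- A finitely generated `R`-module `M` is relative Cohen–Macaulay with respect to the ideal `𝔞`
if there is precisely one `i` such that the local cohomology module `H^i_𝔞(M)` is non-zero. -/
structure IsRelativeCohenMacaulay {R : Type u} [CommRing R] (𝔞 : Ideal R)
    (M : Type u) [AddCommGroup M] [Module R M] : Prop where
  finite : Module.Finite R M
  existsUnique_nontrivial :
    ∃! i : ℕ, Nontrivial ((localCohomology 𝔞 i).obj (ModuleCat.of R M))

/-! Write H^i for H^i_𝔞 and Γ for H^0, the 𝔞-power torsion. Suppose H^i(R) = 0 for all i ≠ j. The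
engine is dimension shifting. If Γ(M) = 0, then M embeds into an injective I with Γ(I) = 0; all
local cohomology of I vanishes, so the cokernel Z satisfies H^i(Z) ≅ H^(i+1)(M). Iterating this
reduces concentration in degree j to concentration in degree 0.

If id R < ∞: in degree 0, Γ carries injectives to injectives (Artin–Rees) and keeps the relevant
short exact sequences exact, since higher cohomology vanishes; so H^j(R) inherits the bound
(`LC.hasInjectiveDimensionLT_of_concentrated`). Conversely, let k be the residue field, which is
killed by 𝔞. In degree 0 the module M/Γ(M) has no local cohomology, hence no Ext from k, and the
vanishing of Ext^p(k, Γ(M)) passes to Ext^p(k, M); the shifts raise p by j in total. So Ext^p(k, R)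
= 0 for large p (`LC.ext_subsingleton_of_concentrated`), and Bass's argument gives id R < ∞
(`ModuleCat.hasInjectiveDimensionLT_of_ext_residueField`).

It remains to see that j = ht 𝔞 (`height_eq_of_concentrated`). Localizing at a minimal prime of 𝔞
reduces this to the maximal ideal 𝔪. Vanishing above the number of generators gives dim R ≥ j. For
dim R ≤ j, parameters are chosen one at a time: the top local cohomology of R/J is Artinian and
equal to 𝔪 times itself, so some x ∈ 𝔪 acts surjectively on it, and passing to R/(J + (x)) lowers
the cohomological dimension. For a regular sequence no height is needed: cohomology vanishes below
its length by regularity and above it by the generator count. -/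

open CategoryTheory Limits Opposite

/-! ### Comparison of the two models of Ext, naturally in the first variable -/

section ExtComparison

lemma CategoryTheory.comp_inv_eq_inv_comp_of_squares {C : Type*} [Category* C]
    {D D' H H' L L' : C} {a : D' ⟶ D} {p : D ⟶ H} {q : D' ⟶ H'} {m : H' ⟶ H}
    (h₁ : a ≫ p = q ≫ m) (e : L ≅ H) (e' : L' ≅ H') {b : L' ⟶ L}
    (h₂ : e'.hom ≫ m = b ≫ e.hom) : a ≫ p ≫ e.inv = (q ≫ e'.inv) ≫ b := by
  rw [reassoc_of% h₁, Category.assoc]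
  congr 1
  rw [Iso.comp_inv_eq, Category.assoc, ← h₂, Iso.inv_hom_id_assoc]

lemma CategoryTheory.comp_comp_eq_comp_comp_of_squares {C : Type*} [Category* C]
    {D D' H H' L L' : C} {a : D' ⟶ D} {p : D ⟶ H} {q : D' ⟶ H'} {m : H' ⟶ H}
    (h₁ : a ≫ p = q ≫ m) {e : H ⟶ L} {e' : H' ⟶ L'} {b : L' ⟶ L}
    (h₂ : m ≫ e = e' ≫ b) : a ≫ p ≫ e = (q ≫ e') ≫ b := by
  rw [reassoc_of% h₁, h₂, Category.assoc]

variable {R : Type u} [CommRing R]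

namespace CategoryTheory.ProjectiveResolution

variable {X Y : ModuleCat.{u} R}

/-- The map on complexes of linear maps induced by a map of chain complexes. -/
noncomputable def linearYonedaMap {P Q : ChainComplex (ModuleCat.{u} R) ℕ} (φ : P ⟶ Q)
    (M : ModuleCat.{u} R) : Q.linearYonedaObj R M ⟶ P.linearYonedaObj R M :=
  (HomologicalComplex.unopFunctor _ _).map
    (((((linearYoneda R (ModuleCat.{u} R)).obj M).rightOp.mapHomologicalComplex _).map φ).op)

/-- Naturality in the first variable is what makes the comparison respect the transition maps R/𝔞^m
→ R/𝔞^n of the direct system. -/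
lemma isoExt_hom_naturality (f : X ⟶ Y) (P : ProjectiveResolution X) (Q : ProjectiveResolution Y)
    (φ : P.complex ⟶ Q.complex) (comm : φ.f 0 ≫ Q.π.f 0 = P.π.f 0 ≫ f) (n : ℕ)
    (M : ModuleCat.{u} R) :
    ((Ext R (ModuleCat.{u} R) n).map f.op).app M ≫ (P.isoExt n M).hom =
      (Q.isoExt n M).hom ≫ HomologicalComplex.homologyMap (linearYonedaMap φ M) n := by
  let F := ((linearYoneda R (ModuleCat.{u} R)).obj M).rightOp
  have h1 : ((F.leftDerived n).map f).unop ≫ (P.isoLeftDerivedObj F n).inv.unop =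
      (Q.isoLeftDerivedObj F n).inv.unop ≫
        (HomologicalComplex.homologyMap ((F.mapHomologicalComplex _).map φ) n).unop :=
    congrArg Quiver.Hom.unop (isoLeftDerivedObj_inv_naturality f P Q φ comm F n)
  let hP := HomologicalComplex.homologyUnop ((F.mapHomologicalComplex _).obj P.complex) n
  let hQ := HomologicalComplex.homologyUnop ((F.mapHomologicalComplex _).obj Q.complex) n
  have h2 : hQ.hom ≫ (HomologicalComplex.homologyMap ((F.mapHomologicalComplex _).map φ) n).unop =
      HomologicalComplex.homologyMap (linearYonedaMap φ M) n ≫ hP.hom :=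
    congrArg Quiver.Hom.unop
      (HomologicalComplex.homologyOp_hom_naturality (linearYonedaMap φ M) n)
  exact comp_inv_eq_inv_comp_of_squares h1 hP hQ h2

variable (P : ProjectiveResolution X) (M : ModuleCat.{u} R) (n : ℕ)

/-- Phrasing this with `prev` matches the boundaries of the Hom complex in every degree: for n = 0
the default value is `prev 0 = 0`, the differential is zero, and the condition becomes f = 0. -/
lemma extMk_eq_zero_iff_prev (f : P.complex.X n ⟶ M)
    (hf : P.complex.d (n + 1) n ≫ f = 0) :
    P.extMk f (n + 1) rfl hf = 0 ↔
      ∃ g : P.complex.X ((ComplexShape.up ℕ).prev n) ⟶ M,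
        P.complex.d n ((ComplexShape.up ℕ).prev n) ≫ g = f := by
  obtain _ | n := n
  · constructor
    · intro h
      simp only [← P.extEquivCohomologyClass.apply_eq_iff_eq, extEquivCohomologyClass_extMk,
        extEquivCohomologyClass_zero, CochainComplex.HomComplex.CohomologyClass.mk_eq_zero_iff] at h
      rw [CochainComplex.HomComplex.Cocycle.toSingleMk_mem_coboundaries_iff _ _ _ _ _ 1
        (by simp)] at h
      obtain ⟨g, hg⟩ := h
      have h1 : IsZero (P.cochainComplex.X 1) :=
        (P.complex.isZero_extend_X ComplexShape.embeddingDownNat 1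
          (by intro i hi; simp at hi; omega))
      have h2 : f = 0 := by
        rw [← cancel_epi (P.cochainComplexXIso (-(0 : ℕ) : ℤ) 0 rfl).hom, ← hg,
          h1.eq_of_src g 0, comp_zero, comp_zero]
      exact ⟨0, by simp [h2]⟩
    · rintro ⟨g, rfl⟩
      simp
  · rw [P.extMk_eq_zero_iff f (n + 1 + 1) rfl hf n rfl, CochainComplex.prev_nat_succ]

lemma smul_extMk (f : P.complex.X n ⟶ M) (hf : P.complex.d (n + 1) n ≫ f = 0) (r : R) :
    P.extMk (r • f) (n + 1) rfl (by simp [hf]) = r • P.extMk f (n + 1) rfl hf := by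
  rw [Abelian.Ext.smul_eq_comp_mk₀, extMk_comp_mk₀]
  congr 1

lemma d_comp_eq_zero
    (f : LinearMap.ker ((P.complex.linearYonedaObj R M).sc n).g.hom) :
    P.complex.d (n + 1) n ≫ (f.1 : P.complex.X n ⟶ M) = 0 := by
  have h1 : P.complex.d ((ComplexShape.up ℕ).next n) n ≫ (f.1 : P.complex.X n ⟶ M) = 0 := f.2
  rwa [CochainComplex.next] at h1

/-- The class in `Ext` of a cocycle of linear maps. -/
noncomputable def extMkLinear :
    LinearMap.ker ((P.complex.linearYonedaObj R M).sc n).g.hom →ₗ[R] Abelian.Ext X M n where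
  toFun f := P.extMk (f.1 : P.complex.X n ⟶ M) (n + 1) rfl (P.d_comp_eq_zero M n f)
  map_add' f g := (P.add_extMk (f.1 : P.complex.X n ⟶ M) g.1 (n + 1) rfl
    (P.d_comp_eq_zero M n f) (P.d_comp_eq_zero M n g)).symm
  map_smul' r f := P.smul_extMk M n f.1 (P.d_comp_eq_zero M n f) r

lemma extMkLinear_surjective : Function.Surjective (P.extMkLinear M n) := by
  intro α
  obtain ⟨f, hf, rfl⟩ := P.extMk_surjective α (n + 1) rfl
  refine ⟨⟨f, ?_⟩, rfl⟩
  have : P.complex.d ((ComplexShape.up ℕ).next n) n ≫ f = 0 := by rwa [CochainComplex.next]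
  exact this

lemma range_moduleCatToCycles_eq_ker_extMkLinear :
    LinearMap.range ((P.complex.linearYonedaObj R M).sc n).moduleCatToCycles =
      LinearMap.ker (P.extMkLinear M n) := by
  ext f
  refine Iff.trans ?_ (P.extMk_eq_zero_iff_prev M n f.1 (P.d_comp_eq_zero M n f)).symm
  constructor
  · rintro ⟨g, hg⟩
    exact ⟨g, congrArg Subtype.val hg⟩
  · rintro ⟨g, hg⟩
    exact ⟨g, Subtype.ext hg⟩

/-- The comparison between the homology of the complex of linear maps out of a projective
resolution and the `Ext` modules. -/
noncomputable def homologyIsoExt :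
    (P.complex.linearYonedaObj R M).homology n ≅ ModuleCat.of R (Abelian.Ext X M n) :=
  ((P.complex.linearYonedaObj R M).sc n).moduleCatHomologyIso ≪≫
    ((Submodule.quotEquivOfEq _ _ (P.range_moduleCatToCycles_eq_ker_extMkLinear M n)).trans
      ((P.extMkLinear M n).quotKerEquivOfSurjective (P.extMkLinear_surjective M n))).toModuleIso

lemma homologyIsoExt_hom_apply (c : (P.complex.linearYonedaObj R M).cycles n) :
    (P.homologyIsoExt M n).hom.hom ((P.complex.linearYonedaObj R M).homologyπ n c) =
      P.extMkLinear M n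
        (((P.complex.linearYonedaObj R M).sc n).moduleCatCyclesIso.hom c) := by
  have h := congrArg (fun f => f.hom c)
    (((P.complex.linearYonedaObj R M).sc n).π_moduleCatCyclesIso_hom)
  have h' : ((P.complex.linearYonedaObj R M).sc n).moduleCatHomologyIso.hom.hom
    ((P.complex.linearYonedaObj R M).homologyπ n c) = Submodule.Quotient.mk 
        (((P.complex.linearYonedaObj R M).sc n).moduleCatCyclesIso.hom c) := h
  refine (congrArg (((Submodule.quotEquivOfEq _ _ (P.range_moduleCatToCycles_eq_ker_extMkLinear M n)).trans
      ((P.extMkLinear M n).quotKerEquivOfSurjective (P.extMkLinear_surjective M n)))) h').trans ?_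
  rfl

lemma homologyIsoExt_hom_naturality {P : ProjectiveResolution X} {Q : ProjectiveResolution Y}
    {f : X ⟶ Y} (φ : Hom P Q f) :
    HomologicalComplex.homologyMap (linearYonedaMap φ.hom M) n ≫ (P.homologyIsoExt M n).hom =
      (Q.homologyIsoExt M n).hom ≫
        ModuleCat.ofHom ((Abelian.Ext.mk₀ f).precompOfLinear R M (zero_add n)) := by
  rw [← cancel_epi ((Q.complex.linearYonedaObj R M).homologyπ n)]
  ext c
  have h1 := congrArg (fun f => f.hom c)
    (HomologicalComplex.homologyπ_naturality (linearYonedaMap φ.hom M) n)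
  refine (congrArg (P.homologyIsoExt M n).hom.hom h1).trans ?_
  refine (P.homologyIsoExt_hom_apply M n _).trans ?_
  refine Eq.trans ?_ (congrArg ((Abelian.Ext.mk₀ f).precompOfLinear R M (zero_add n))
    (Q.homologyIsoExt_hom_apply M n c)).symm
  let K := P.complex.linearYonedaObj R M
  let L := Q.complex.linearYonedaObj R M
  have h2 : ((K.sc n).moduleCatCyclesIso.hom
      (HomologicalComplex.cyclesMap (linearYonedaMap φ.hom M) n c)).1 =
        φ.hom.f n ≫ ((L.sc n).moduleCatCyclesIso.hom c).1 := by
    have e1 := congrArg (fun f => f.hom (HomologicalComplex.cyclesMap (linearYonedaMap φ.hom M) n c))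
      (K.sc n).moduleCatCyclesIso_hom_i
    have e2 := congrArg (fun f => f.hom c)
      (HomologicalComplex.cyclesMap_i (linearYonedaMap φ.hom M) n)
    have e3 := congrArg (fun f => f.hom c) (L.sc n).moduleCatCyclesIso_hom_i
    exact (e1.trans e2).trans (congrArg (fun g : Q.complex.X n ⟶ M => φ.hom.f n ≫ g) e3.symm)
  refine Eq.trans ?_ (mk₀_comp_extMk _ _ rfl (Q.d_comp_eq_zero M n _) φ).symm
  have h3 : ∀ (f g : P.complex.X n ⟶ M) (hf : P.complex.d (n + 1) n ≫ f = 0)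
      (hg : P.complex.d (n + 1) n ≫ g = 0), f = g → P.extMk f _ rfl hf = P.extMk g _ rfl hg := by
    rintro f _ _ _ rfl; rfl
  exact h3 _ _ (P.d_comp_eq_zero M n _) _ h2

end CategoryTheory.ProjectiveResolution

namespace ModuleCat

/-- The contravariant `Ext` functor with values in modules. -/
noncomputable def extContra (M : ModuleCat.{u} R) (n : ℕ) :
    (ModuleCat.{u} R)ᵒᵖ ⥤ ModuleCat.{u} R where
  obj X := ModuleCat.of R (Abelian.Ext X.unop M n)
  map f := ModuleCat.ofHom ((Abelian.Ext.mk₀ f.unop).precompOfLinear R M (zero_add n))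
  map_id X := by
    ext x
    exact Abelian.Ext.mk₀_id_comp x
  map_comp f g := by
    ext x
    exact (Abelian.Ext.mk₀_comp_mk₀_assoc g.unop f.unop x).symm

/-- The comparison between the two definitions of `Ext` modules. -/
noncomputable def extFlipIso (M : ModuleCat.{u} R) (n : ℕ) :
    Ext R (ModuleCat.{u} R) n ⋙ (evaluation _ _).obj M ≅ extContra M n :=
  NatIso.ofComponents
    (fun X => (CategoryTheory.projectiveResolution X.unop).isoExt n M ≪≫
      (CategoryTheory.projectiveResolution X.unop).homologyIsoExt M n)
    (fun {X Y} f => by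
      let P := CategoryTheory.projectiveResolution Y.unop
      let Q := CategoryTheory.projectiveResolution X.unop
      let φ : ProjectiveResolution.Hom P Q f.unop :=
        ⟨ProjectiveResolution.lift f.unop P Q, by
          simpa using ProjectiveResolution.lift_commutes_zero f.unop P Q⟩
      have h1 := ProjectiveResolution.isoExt_hom_naturality f.unop P Q φ.hom
        (ProjectiveResolution.lift_commutes_zero f.unop P Q) n M
      have h2 := ProjectiveResolution.homologyIsoExt_hom_naturality M n φ
      exact comp_comp_eq_comp_comp_of_squares h1 h2)

end ModuleCat

end ExtComparison

/-! ### Local cohomology as a direct limit of Ext modules, and its long exact sequence -/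

section LocalCohomologyModel

variable {R : Type u} [CommRing R]

/-- The direct system of modules `Ext^i(R/𝔞^n, M)`. -/
noncomputable def localCohomologySystem (𝔞 : Ideal R) (i : ℕ) (M : ModuleCat.{u} R) :
    ℕᵒᵖᵒᵖ ⥤ ModuleCat.{u} R :=
  (localCohomology.ringModIdeals (localCohomology.idealPowersDiagram 𝔞)).op ⋙ M.extContra i

/-- Local cohomology as the direct limit of the modules `Ext^i(R/𝔞^n, M)`. -/
noncomputable def LC (𝔞 : Ideal R) (i : ℕ) (M : ModuleCat.{u} R) : ModuleCat.{u} R :=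
  colimit (localCohomologySystem 𝔞 i M)

/-- The comparison with the local cohomology functor of Mathlib. -/
noncomputable def localCohomologyIsoLC (𝔞 : Ideal R) (i : ℕ) (M : ModuleCat.{u} R) :
    (localCohomology 𝔞 i).obj M ≅ LC 𝔞 i M :=
  colimitObjIsoColimitCompEvaluation
      (localCohomology.diagram (localCohomology.idealPowersDiagram 𝔞) i) M ≪≫
    HasColimit.isoOfNatIso (Functor.isoWhiskerLeft
      (localCohomology.ringModIdeals (localCohomology.idealPowersDiagram 𝔞)).op
        (M.extFlipIso i))

instance : PreservesFilteredColimitsOfSize.{0, 0} (forget (ModuleCat.{u} R)) :=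
  preservesSmallestFilteredColimits_of_preservesFilteredColimits _

namespace LC

variable (𝔞 : Ideal R)

/-- The module `R/𝔞^n`. -/
abbrev quotPow (n : ℕ) : ModuleCat.{u} R := ModuleCat.of R (R ⧸ 𝔞 ^ n)

/-- The projection `R/𝔞^m → R/𝔞^n`. -/
noncomputable def tr {n m : ℕ} (h : n ≤ m) : quotPow 𝔞 m ⟶ quotPow 𝔞 n :=
  (localCohomology.ringModIdeals (localCohomology.idealPowersDiagram 𝔞)).map (homOfLE h).op

variable {i : ℕ} {M N : ModuleCat.{u} R}

/-- The structure map `Ext^i(R/𝔞^n, M) → H^i_𝔞(M)`. -/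
noncomputable def ι (n : ℕ) : Abelian.Ext (quotPow 𝔞 n) M i →ₗ[R] LC 𝔞 i M :=
  (colimit.ι (localCohomologySystem 𝔞 i M) (op (op n))).hom

lemma exists_rep (z : LC 𝔞 i M) : ∃ (n : ℕ) (ξ : Abelian.Ext (quotPow 𝔞 n) M i), ι 𝔞 n ξ = z := by
  obtain ⟨j, y, hy⟩ := Concrete.colimit_exists_rep (localCohomologySystem 𝔞 i M) z
  exact ⟨j.unop.unop, y, hy⟩

lemma ι_tr {n m : ℕ} (h : n ≤ m) (ξ : Abelian.Ext (quotPow 𝔞 n) M i) :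
    ι 𝔞 m ((Abelian.Ext.mk₀ (tr 𝔞 h)).comp ξ (zero_add i)) = ι 𝔞 n ξ :=
  congrArg (fun f => f.hom ξ)
    (colimit.w (localCohomologySystem 𝔞 i M) (homOfLE h).op.op)

lemma ι_eq_zero_iff {n : ℕ} (ξ : Abelian.Ext (quotPow 𝔞 n) M i) :
    ι 𝔞 n ξ = 0 ↔ ∃ (m : ℕ) (h : n ≤ m), 
      (Abelian.Ext.mk₀ (tr 𝔞 h)).comp ξ (zero_add i) = 0 := by
  constructor
  · intro h
    have h' : (colimit.ι (localCohomologySystem 𝔞 i M) (op (op n))) ξ =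
      (colimit.ι (localCohomologySystem 𝔞 i M) (op (op n))) 
        (0 : Abelian.Ext (quotPow 𝔞 n) M i) := h.trans (map_zero (ι 𝔞 n)).symm
    obtain ⟨k, f, g, hfg⟩ := Concrete.colimit_exists_of_rep_eq (localCohomologySystem 𝔞 i M) _ _ h'
    refine ⟨k.unop.unop, leOfHom f.unop.unop, ?_⟩
    exact hfg.trans (map_zero ((localCohomologySystem 𝔞 i M).map g).hom)
  · rintro ⟨m, h, h0⟩
    rw [← ι_tr 𝔞 h, h0, map_zero]

/-- Composition with a class in `Ext^b(M, N)` on the direct systems. -/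
noncomputable def systemMap {b c : ℕ} (β : Abelian.Ext M N b) (h : i + b = c) :
    localCohomologySystem 𝔞 i M ⟶ localCohomologySystem 𝔞 c N where
  app j := ModuleCat.ofHom (β.postcompOfLinear R _ h)
  naturality j k f := by
    ext ξ
    exact Abelian.Ext.comp_assoc (Abelian.Ext.mk₀ _) ξ β (zero_add i) h (by omega)

/-- Composition with a class in `Ext^b(M, N)`. -/
noncomputable def post {b c : ℕ} (β : Abelian.Ext M N b) (h : i + b = c) :
    LC 𝔞 i M →ₗ[R] LC 𝔞 c N :=
  (colimMap (systemMap 𝔞 β h)).hom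

lemma post_ι {b c : ℕ} (β : Abelian.Ext M N b) (h : i + b = c) {n : ℕ}
    (ξ : Abelian.Ext (quotPow 𝔞 n) M i) : post 𝔞 β h (ι 𝔞 n ξ) = ι 𝔞 n (ξ.comp β h) :=
  congrArg (fun f => f.hom ξ) (ι_colimMap (systemMap 𝔞 β h) (op (op n)))

lemma post_post {b c d e : ℕ} {P : ModuleCat.{u} R} (β : Abelian.Ext M N b) (γ : Abelian.Ext N P d)
    (h : i + b = c) (h' : c + d = e) {k : ℕ} (hk : b + d = k) (z : LC 𝔞 i M) :
    post 𝔞 γ h' (post 𝔞 β h z) = post 𝔞 (β.comp γ hk) (by omega : i + k = e) z := by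
  obtain ⟨n, ξ, rfl⟩ := exists_rep 𝔞 z
  simp only [post_ι]
  rw [Abelian.Ext.comp_assoc]
  omega

/-- Functoriality of local cohomology. -/
noncomputable def map (i : ℕ) (f : M ⟶ N) : LC 𝔞 i M →ₗ[R] LC 𝔞 i N :=
  post 𝔞 (Abelian.Ext.mk₀ f) (add_zero i)

lemma map_map {P : ModuleCat.{u} R} (f : M ⟶ N) (g : N ⟶ P) (z : LC 𝔞 i M) :
    map 𝔞 i g (map 𝔞 i f z) = map 𝔞 i (f ≫ g) z := by
  rw [map, map, post_post _ _ _ _ _ (add_zero 0), Abelian.Ext.mk₀_comp_mk₀, map]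

lemma map_id (z : LC 𝔞 i M) : map 𝔞 i (𝟙 M) z = z := by
  obtain ⟨n, ξ, rfl⟩ := exists_rep 𝔞 z
  simp [map, post_ι]

lemma map_smul_id (r : R) (z : LC 𝔞 i M) : map 𝔞 i (r • 𝟙 M) z = r • z := by
  obtain ⟨n, ξ, rfl⟩ := exists_rep 𝔞 z
  rw [map, post_ι, ← Abelian.Ext.smul_eq_comp_mk₀, map_smul]

lemma map_add (f g : M ⟶ N) (z : LC 𝔞 i M) :
    map 𝔞 i (f + g) z = map 𝔞 i f z + map 𝔞 i g z := by
  obtain ⟨n, ξ, rfl⟩ := exists_rep 𝔞 z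
  simp only [map, post_ι, Abelian.Ext.mk₀_add, Abelian.Ext.comp_add, _root_.map_add]

lemma map_zero (z : LC 𝔞 i M) : map 𝔞 i (0 : M ⟶ N) z = 0 := by
  obtain ⟨n, ξ, rfl⟩ := exists_rep 𝔞 z
  simp [map, post_ι]

/-- Isomorphic modules have isomorphic local cohomology. -/
noncomputable def mapEquiv (i : ℕ) (e : M ≅ N) : LC 𝔞 i M ≃ₗ[R] LC 𝔞 i N :=
  LinearEquiv.ofLinearMap (map 𝔞 i e.hom) (map 𝔞 i e.inv)
    (by ext z; simp [map_map, map_id]) (by ext z; simp [map_map, map_id])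

section LongExactSequence

variable {S : ShortComplex (ModuleCat.{u} R)} (hS : S.ShortExact)

lemma map_comp_eq_zero (S : ShortComplex (ModuleCat.{u} R)) (i : ℕ) (z : LC 𝔞 i S.X₁) :
    map 𝔞 i S.g (map 𝔞 i S.f z) = 0 := by
  rw [map_map, S.zero, map_zero]

include hS

/-- Filtered colimits are exact: a class that dies in the limit dies already over some higher power
𝔞^m, and there the long exact sequence of Ext applies. The other two exactness statements follow the
same pattern. -/
lemma exact₂ (i : ℕ) (z : LC 𝔞 i S.X₂) (hz : map 𝔞 i S.g z = 0) :
    ∃ y, map 𝔞 i S.f y = z := by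
  obtain ⟨n, ξ, rfl⟩ := exists_rep 𝔞 z
  rw [map, post_ι, ι_eq_zero_iff] at hz
  obtain ⟨m, h, h0⟩ := hz
  obtain ⟨x, hx⟩ := Abelian.Ext.covariant_sequence_exact₂ _ hS
    ((Abelian.Ext.mk₀ (tr 𝔞 h)).comp ξ (zero_add i))
    (by rwa [Abelian.Ext.comp_assoc_of_third_deg_zero])
  exact ⟨ι 𝔞 m x, by rw [map, post_ι, hx, ι_tr]⟩

/-- The connecting homomorphism. -/
noncomputable def δ (i : ℕ) : LC 𝔞 i S.X₃ →ₗ[R] LC 𝔞 (i + 1) S.X₁ :=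
  post 𝔞 hS.extClass rfl

lemma exact₃ (i : ℕ) (z : LC 𝔞 i S.X₃) (hz : δ 𝔞 hS i z = 0) :
    ∃ y, map 𝔞 i S.g y = z := by
  obtain ⟨n, ξ, rfl⟩ := exists_rep 𝔞 z
  rw [δ, post_ι, ι_eq_zero_iff] at hz
  obtain ⟨m, h, h0⟩ := hz
  obtain ⟨x, hx⟩ := Abelian.Ext.covariant_sequence_exact₃ _ hS
    ((Abelian.Ext.mk₀ (tr 𝔞 h)).comp ξ (zero_add i)) rfl
    (by rwa [Abelian.Ext.comp_assoc]; omega)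
  exact ⟨ι 𝔞 m x, by rw [map, post_ι, hx, ι_tr]⟩

lemma exact₁ (i : ℕ) (z : LC 𝔞 (i + 1) S.X₁) (hz : map 𝔞 (i + 1) S.f z = 0) :
    ∃ y, δ 𝔞 hS i y = z := by
  obtain ⟨n, ξ, rfl⟩ := exists_rep 𝔞 z
  rw [map, post_ι, ι_eq_zero_iff] at hz
  obtain ⟨m, h, h0⟩ := hz
  obtain ⟨x, hx⟩ := Abelian.Ext.covariant_sequence_exact₁ _ hS
    ((Abelian.Ext.mk₀ (tr 𝔞 h)).comp ξ (zero_add (i + 1)))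
    (by rwa [Abelian.Ext.comp_assoc_of_third_deg_zero]) rfl
  exact ⟨ι 𝔞 m x, by rw [δ, post_ι, hx, ι_tr]⟩

lemma δ_map_eq_zero (i : ℕ) (z : LC 𝔞 i S.X₂) : δ 𝔞 hS i (map 𝔞 i S.g z) = 0 := by
  rw [δ, map, post_post _ _ _ _ _ (zero_add 1), hS.comp_extClass]
  obtain ⟨n, ξ, rfl⟩ := exists_rep 𝔞 z
  simp [post_ι]

lemma subsingleton₂ (i : ℕ) [Subsingleton (LC 𝔞 i S.X₁)] [Subsingleton (LC 𝔞 i S.X₃)] :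
    Subsingleton (LC 𝔞 i S.X₂) := by
  refine subsingleton_of_forall_eq 0 fun z => ?_
  obtain ⟨y, rfl⟩ := exact₂ 𝔞 hS i z (Subsingleton.elim _ _)
  rw [Subsingleton.elim y 0, _root_.map_zero]

lemma subsingleton₃ (i : ℕ) [Subsingleton (LC 𝔞 i S.X₂)] [Subsingleton (LC 𝔞 (i + 1) S.X₁)] :
    Subsingleton (LC 𝔞 i S.X₃) := by
  refine subsingleton_of_forall_eq 0 fun z => ?_
  obtain ⟨y, rfl⟩ := exact₃ 𝔞 hS i z (Subsingleton.elim _ _)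
  rw [Subsingleton.elim y 0, _root_.map_zero]

lemma subsingleton₁ (i : ℕ) [Subsingleton (LC 𝔞 i S.X₃)] [Subsingleton (LC 𝔞 (i + 1) S.X₂)] :
    Subsingleton (LC 𝔞 (i + 1) S.X₁) := by
  refine subsingleton_of_forall_eq 0 fun z => ?_
  obtain ⟨y, rfl⟩ := exact₁ 𝔞 hS i z (Subsingleton.elim _ _)
  rw [Subsingleton.elim y 0, _root_.map_zero]

/-- The connecting homomorphism is an isomorphism if the cohomology of the middle term vanishes. -/
noncomputable def δEquiv (i : ℕ) [Subsingleton (LC 𝔞 i S.X₂)] [Subsingleton (LC 𝔞 (i + 1) S.X₂)] :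
    LC 𝔞 i S.X₃ ≃ₗ[R] LC 𝔞 (i + 1) S.X₁ :=
  LinearEquiv.ofBijective (δ 𝔞 hS i)
    ⟨by
      rw [injective_iff_map_eq_zero]
      intro z hz
      obtain ⟨y, rfl⟩ := exact₃ 𝔞 hS i z hz
      rw [Subsingleton.elim y 0, _root_.map_zero],
    fun z => exact₁ 𝔞 hS i z (Subsingleton.elim _ _)⟩

end LongExactSequence

instance subsingleton_of_injective (i : ℕ) (I : ModuleCat.{u} R) [Injective I] :
    Subsingleton (LC 𝔞 (i + 1) I) := by
  refine subsingleton_of_forall_eq 0 fun z => ?_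
  obtain ⟨n, ξ, rfl⟩ := exists_rep 𝔞 z
  rw [ξ.eq_zero_of_injective, _root_.map_zero]

instance subsingleton_of_subsingleton (i : ℕ) (M : ModuleCat.{u} R) [Subsingleton M] :
    Subsingleton (LC 𝔞 i M) := by
  refine subsingleton_of_forall_eq 0 fun z => ?_
  rw [← map_id 𝔞 z, (ModuleCat.isZero_of_subsingleton M).eq_of_src (𝟙 M) 0, map_zero]

/-- A class comes from Ext^i(R/𝔞^n, M), and r^n acts as zero on the first argument. -/
lemma exists_pow_smul_eq_zero {r : R} (hr : r ∈ 𝔞) (z : LC 𝔞 i M) : ∃ n : ℕ, r ^ n • z = 0 := by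
  obtain ⟨n, ξ, rfl⟩ := exists_rep 𝔞 z
  refine ⟨n, ?_⟩
  rw [← _root_.map_smul]
  have h : (r ^ n • 𝟙 (quotPow 𝔞 n) : quotPow 𝔞 n ⟶ quotPow 𝔞 n) = 0 := by
    refine ModuleCat.hom_ext (LinearMap.ext fun x => ?_)
    obtain ⟨y, rfl⟩ := Ideal.Quotient.mk_surjective x
    exact Ideal.Quotient.eq_zero_iff_mem.mpr (Ideal.mul_mem_right _ _ (Ideal.pow_mem_pow hr n))
  rw [← Abelian.Ext.mk₀_id_comp ξ, ← Abelian.Ext.smul_comp, ← Abelian.Ext.mk₀_smul, h,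
    Abelian.Ext.mk₀_zero, Abelian.Ext.zero_comp, _root_.map_zero]

/-- Local cohomology supported in the zero ideal vanishes in positive degrees. -/
instance subsingleton_bot (i : ℕ) (M : ModuleCat.{u} R) :
    Subsingleton (LC (⊥ : Ideal R) (i + 1) M) := by
  refine subsingleton_of_forall_eq 0 fun z => ?_
  obtain ⟨n, ξ, rfl⟩ := exists_rep _ z
  -- Passing to exponent n + 1 avoids ⊥^0 = ⊤; then the quotient is R itself, which is projective.
  rw [← ι_tr _ n.le_succ]
  have : Projective (quotPow (⊥ : Ideal R) (n + 1)) := by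
    have e : quotPow (⊥ : Ideal R) (n + 1) ≅ ModuleCat.of R R :=
      (Submodule.quotEquivOfEqBot _ (by
        rw [← Ideal.zero_eq_bot, zero_pow n.succ_ne_zero])).toModuleIso
    exact Projective.of_iso e.symm (ModuleCat.projective_of_free (Module.Basis.singleton Unit R))
  rw [Abelian.Ext.eq_zero_of_projective (Abelian.Ext.comp _ ξ _), _root_.map_zero]

end LC

end LocalCohomologyModel

/-! ### The torsion functor Γ and its effect on injectives -/

section PowTorsion

variable {R : Type u} [CommRing R]

/-- The submodule `Γ_𝔞(M)` of elements killed by a power of `𝔞`. -/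
def powTorsion (𝔞 : Ideal R) (M : Type*) [AddCommGroup M] [Module R M] : Submodule R M where
  carrier := {m | ∃ n : ℕ, ∀ r ∈ 𝔞 ^ n, r • m = 0}
  zero_mem' := ⟨0, by simp⟩
  add_mem' := by
    rintro x y ⟨n, hn⟩ ⟨m, hm⟩
    exact ⟨n + m, fun r hr => by
      rw [smul_add, hn r (Ideal.pow_le_pow_right (Nat.le_add_right _ _) hr),
        hm r (Ideal.pow_le_pow_right (Nat.le_add_left _ _) hr), add_zero]⟩
  smul_mem' := by
    rintro c x ⟨n, hn⟩
    exact ⟨n, fun r hr => by rw [smul_comm, hn r hr, smul_zero]⟩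

section

variable {𝔞 : Ideal R} {M N : Type*} [AddCommGroup M] [Module R M] [AddCommGroup N] [Module R N]

lemma map_mem_powTorsion (f : M →ₗ[R] N) {m : M} (hm : m ∈ powTorsion 𝔞 M) :
    f m ∈ powTorsion 𝔞 N := by
  obtain ⟨n, hn⟩ := hm
  exact ⟨n, fun r hr => by rw [← map_smul, hn r hr, map_zero]⟩

lemma mem_powTorsion_of_injective {f : M →ₗ[R] N} (hf : Function.Injective f) {m : M}
    (hm : f m ∈ powTorsion 𝔞 N) : m ∈ powTorsion 𝔞 M := by
  obtain ⟨n, hn⟩ := hm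
  exact ⟨n, fun r hr => hf (by rw [map_smul, hn r hr, map_zero])⟩

lemma powTorsion_eq_top_of_surjective {f : M →ₗ[R] N} (hf : Function.Surjective f)
    (h : powTorsion 𝔞 M = ⊤) : powTorsion 𝔞 N = ⊤ := by
  refine eq_top_iff.mpr fun y _ => ?_
  obtain ⟨x, rfl⟩ := hf y
  exact map_mem_powTorsion f (h ▸ Submodule.mem_top)

lemma powTorsion_powTorsion : powTorsion 𝔞 (powTorsion 𝔞 M) = ⊤ :=
  eq_top_iff.mpr fun m _ => mem_powTorsion_of_injective
    (Submodule.injective_subtype (powTorsion 𝔞 M)) m.2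

lemma powTorsion_bot : powTorsion (⊥ : Ideal R) M = ⊤ :=
  eq_top_iff.mpr fun m _ => ⟨1, fun r hr => by
    rw [pow_one, Ideal.mem_bot] at hr
    rw [hr, zero_smul]⟩

lemma powTorsion_eq_top_of_le_annihilator (h : 𝔞 ≤ Module.annihilator R M) :
    powTorsion 𝔞 M = ⊤ :=
  eq_top_iff.mpr fun m _ => ⟨1, fun r hr => by
    rw [pow_one] at hr
    exact Module.mem_annihilator.mp (h hr) m⟩

lemma exists_forall_smul_eq_zero_of_fg {S : Submodule R M} (hS : S.FG)
    (h : S ≤ powTorsion 𝔞 M) : ∃ n : ℕ, ∀ r ∈ 𝔞 ^ n, ∀ m ∈ S, r • m = 0 := by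
  induction S, hS using Submodule.fg_induction with
  | singleton x =>
    obtain ⟨n, hn⟩ := h (Submodule.mem_span_singleton_self x)
    refine ⟨n, fun r hr m hm => ?_⟩
    obtain ⟨c, rfl⟩ := Submodule.mem_span_singleton.mp hm
    rw [smul_comm, hn r hr, smul_zero]
  | sup S₁ S₂ _ _ h₁ h₂ =>
    obtain ⟨n, hn⟩ := h₁ (le_sup_left.trans h)
    obtain ⟨k, hk⟩ := h₂ (le_sup_right.trans h)
    refine ⟨n + k, fun r hr m hm => ?_⟩
    obtain ⟨x, hx, y, hy, rfl⟩ := Submodule.mem_sup.mp hm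
    rw [smul_add, hn r (Ideal.pow_le_pow_right (Nat.le_add_right _ _) hr) x hx,
      hk r (Ideal.pow_le_pow_right (Nat.le_add_left _ _) hr) y hy, add_zero]

/-- If 𝔞^n x consists of torsion elements then, being finitely generated, it is killed by a single
𝔞^k; hence 𝔞^(k+n) kills x. -/
lemma powTorsion_quotient_powTorsion [IsNoetherianRing R] :
    powTorsion 𝔞 (M ⧸ powTorsion 𝔞 M) = ⊥ := by
  refine eq_bot_iff.mpr fun m hm => ?_
  obtain ⟨x, rfl⟩ := Submodule.mkQ_surjective _ m
  obtain ⟨n, hn⟩ := hm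
  have hx : Submodule.map (LinearMap.toSpanSingleton R M x) (𝔞 ^ n) ≤ powTorsion 𝔞 M := by
    rintro _ ⟨r, hr, rfl⟩
    exact (Submodule.Quotient.mk_eq_zero _).mp (hn r hr)
  obtain ⟨k, hk⟩ := exists_forall_smul_eq_zero_of_fg
    (Submodule.FG.map _ (IsNoetherian.noetherian (𝔞 ^ n))) hx
  refine (Submodule.Quotient.mk_eq_zero _).mpr ⟨k + n, fun r hr => ?_⟩
  rw [pow_add] at hr
  refine Submodule.mul_induction_on hr (fun a ha b hb => ?_) (fun a b ha hb => ?_)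
  · rw [mul_smul]
    exact hk a ha _ ⟨b, hb, rfl⟩
  · rw [add_smul, ha, hb, add_zero]

end

/-- Over a Noetherian ring the torsion submodule of an injective module is injective. -/
lemma injective_powTorsion [IsNoetherianRing R] (𝔞 : Ideal R) (I : Type u) [AddCommGroup I]
    [Module R I] [Module.Injective R I] : Module.Injective R (powTorsion 𝔞 I) := by
  refine Module.Baer.injective fun J g => ?_
  obtain ⟨n, hn⟩ := exists_forall_smul_eq_zero_of_fg (𝔞 := 𝔞) (S := LinearMap.range g)
    (Module.Finite.iff_fg.mp (Module.Finite.range g)) (by rw [powTorsion_powTorsion]; exact le_top)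
  obtain ⟨k, hk⟩ := Ideal.exists_pow_inf_eq_pow_smul 𝔞 J
  -- Artin–Rees places J ∩ 𝔞^(n+k) inside 𝔞^n J, which g kills because 𝔞^n kills its image.
  have hkey : Submodule.comap J.subtype (𝔞 ^ (n + k)) ≤ LinearMap.ker g := by
    intro x hx
    have hx' : x.1 ∈ 𝔞 ^ n • J := by
      have : x.1 ∈ 𝔞 ^ (n + k) • (⊤ : Submodule R R) ⊓ J := ⟨by simpa using hx, x.2⟩
      rw [hk (n + k) (Nat.le_add_left _ _), Nat.add_sub_cancel] at this
      exact Submodule.smul_mono le_rfl inf_le_right this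
    have h2 : ∀ y (hy : y ∈ 𝔞 ^ n • J), g ⟨y, Submodule.smul_le_right hy⟩ = 0 := by
      intro y hy
      induction hy using Submodule.smul_induction_on' with
      | smul r hr z hz =>
        have : (⟨r • z, J.smul_mem r hz⟩ : J) = r • ⟨z, hz⟩ := rfl
        rw [this, map_smul]
        exact hn r hr _ ⟨_, rfl⟩
      | add y hy z hz h1 h2 =>
        have := congrArg₂ (· + ·) h1 h2
        simp only [add_zero, ← map_add] at this
        exact this
    exact h2 _ hx'
  -- So g factors through a submodule of R/𝔞^(n+k). An extension to that module with values in I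
  -- lands in the torsion part automatically, which verifies Baer's criterion.
  let f : (J ⧸ Submodule.comap J.subtype (𝔞 ^ (n + k))) →ₗ[R] R ⧸ 𝔞 ^ (n + k) :=
    Submodule.mapQ _ _ J.subtype le_rfl
  have hf : Function.Injective f := by
    rw [← LinearMap.ker_eq_bot]
    exact Submodule.ker_liftQ_eq_bot _ _ _ (by rw [LinearMap.ker_comp, Submodule.ker_mkQ])
  obtain ⟨h, hh⟩ := Module.Injective.out f hf
    ((powTorsion 𝔞 I).subtype ∘ₗ Submodule.liftQ _ g hkey)
  refine ⟨LinearMap.codRestrict _ (h ∘ₗ Submodule.mkQ _) fun r => ⟨n + k, fun s hs => ?_⟩,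
    fun x hx => Subtype.ext (hh (Submodule.Quotient.mk ⟨x, hx⟩))⟩
  rw [← map_smul]
  change h (Submodule.Quotient.mk (s * r)) = 0
  rw [(Submodule.Quotient.mk_eq_zero _).mpr (Ideal.mul_mem_right r _ hs), map_zero]

end PowTorsion

/-! ### Embeddings into torsion-free and torsion injectives -/

section Embeddings

variable {R : Type u} [CommRing R]

/-- The short exact sequence attached to a submodule. -/
noncomputable abbrev Submodule.shortComplex {M : Type u} [AddCommGroup M] [Module R M]
    (N : Submodule R M) : ShortComplex (ModuleCat.{u} R) :=
  ModuleCat.shortComplexOfCompEqZero N.subtype N.mkQ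
    (LinearMap.ext fun x => (Submodule.Quotient.mk_eq_zero N).mpr x.2)

lemma Submodule.shortExact_shortComplex {M : Type u} [AddCommGroup M] [Module R M]
    (N : Submodule R M) : N.shortComplex.ShortExact :=
  ModuleCat.shortComplex_shortExact _ (LinearMap.exact_subtype_mkQ N) N.injective_subtype
    N.mkQ_surjective

/-- The short exact sequence attached to an injective linear map. -/
noncomputable abbrev LinearMap.shortComplexCoker {M N : Type u} [AddCommGroup M] [Module R M]
    [AddCommGroup N] [Module R N] (f : M →ₗ[R] N) : ShortComplex (ModuleCat.{u} R) :=
  ModuleCat.shortComplexOfCompEqZero f f.range.mkQ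
    (LinearMap.ext fun x => (Submodule.Quotient.mk_eq_zero _).mpr ⟨x, rfl⟩)

lemma LinearMap.shortExact_shortComplexCoker {M N : Type u} [AddCommGroup M] [Module R M]
    [AddCommGroup N] [Module R N] {f : M →ₗ[R] N} (hf : Function.Injective f) :
    f.shortComplexCoker.ShortExact :=
  ModuleCat.shortComplex_shortExact _ f.exact_map_mkQ_range hf f.range.mkQ_surjective

lemma exists_injective_embedding (M : Type u) [AddCommGroup M] [Module R M] :
    ∃ (I : Type u) (_ : AddCommGroup I) (_ : Module R I) (f : M →ₗ[R] I),
      Module.Injective R I ∧ Function.Injective f := by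
  obtain ⟨I, hI, f, hf⟩ := EnoughInjectives.presentation (ModuleCat.of R M)
  exact ⟨I, inferInstance, inferInstance, f.hom, Module.injective_module_of_injective_object R I,
    (ModuleCat.mono_iff_injective f).mp hf⟩

variable [IsNoetherianRing R]

/-- A module without `𝔞`-torsion embeds into an injective module without `𝔞`-torsion. -/
lemma exists_injective_embedding_of_powTorsion_eq_bot {𝔞 : Ideal R} {M : Type u} [AddCommGroup M]
    [Module R M] (h : powTorsion 𝔞 M = ⊥) :
    ∃ (I : Type u) (_ : AddCommGroup I) (_ : Module R I) (f : M →ₗ[R] I),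
      Module.Injective R I ∧ Function.Injective f ∧ powTorsion 𝔞 I = ⊥ := by
  obtain ⟨I, _, _, f, hI, hf⟩ := exists_injective_embedding (R := R) M
  have hinj := injective_powTorsion 𝔞 I
  obtain ⟨r, hr⟩ := Module.Injective.out (powTorsion 𝔞 I).subtype
    (powTorsion 𝔞 I).injective_subtype LinearMap.id
  refine ⟨I ⧸ powTorsion 𝔞 I, inferInstance, inferInstance, (powTorsion 𝔞 I).mkQ ∘ₗ f,
    ⟨fun X Y _ _ _ _ i hi g => ?_⟩, ?_, powTorsion_quotient_powTorsion⟩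
  -- As Γ(I) is injective it is a retract of I by r; subtracting r from the identity gives a section
  -- s of the projection. The quotient is therefore a direct summand of I, hence injective.
  · let s : I ⧸ powTorsion 𝔞 I →ₗ[R] I := Submodule.liftQ _
      (LinearMap.id - (powTorsion 𝔞 I).subtype ∘ₗ r) fun x hx => by
        have := hr ⟨x, hx⟩
        simp only [Submodule.subtype_apply, LinearMap.id_apply] at this
        simp [this]
    obtain ⟨h, hh⟩ := Module.Injective.out i hi (s ∘ₗ g)
    refine ⟨(powTorsion 𝔞 I).mkQ ∘ₗ h, fun x => ?_⟩
    rw [LinearMap.comp_apply, hh]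
    obtain ⟨y, hy⟩ := Submodule.mkQ_surjective _ (g x)
    rw [LinearMap.comp_apply, ← hy]
    simp only [s, Submodule.mkQ_apply, Submodule.liftQ_apply]
    refine (Submodule.Quotient.eq _).mpr ?_
    simp
  · rw [← LinearMap.ker_eq_bot, LinearMap.ker_comp, Submodule.ker_mkQ, eq_bot_iff]
    intro x hx
    rw [← h]
    exact mem_powTorsion_of_injective hf hx

/-- An `𝔞`-torsion module embeds into an injective `𝔞`-torsion module. -/
lemma exists_injective_embedding_of_powTorsion_eq_top {𝔞 : Ideal R} {M : Type u} [AddCommGroup M]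
    [Module R M] (h : powTorsion 𝔞 M = ⊤) :
    ∃ (I : Type u) (_ : AddCommGroup I) (_ : Module R I) (f : M →ₗ[R] I),
      Module.Injective R I ∧ Function.Injective f ∧ powTorsion 𝔞 I = ⊤ := by
  obtain ⟨I, _, _, f, hI, hf⟩ := exists_injective_embedding (R := R) M
  refine ⟨powTorsion 𝔞 I, inferInstance, inferInstance,
    f.codRestrict _ fun x => map_mem_powTorsion f (h ▸ Submodule.mem_top),
    injective_powTorsion 𝔞 I, ?_, powTorsion_powTorsion⟩
  intro x y hxy
  exact hf (congrArg Subtype.val hxy)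

end Embeddings

/-! ### Degree zero, and reading higher vanishing off Γ -/

section DegreeZero

variable {R : Type u} [CommRing R]

namespace LC

variable (𝔞 : Ideal R) (M : ModuleCat.{u} R)

/-- Evaluation at `1` of a class in `Ext^0(R/I, M)`. -/
noncomputable def evalOne (I : Ideal R) :
    Abelian.Ext (ModuleCat.of R (R ⧸ I)) M 0 →ₗ[R] M where
  toFun ξ := (Abelian.Ext.linearEquiv₀ (R := R) ξ).hom (1 : R ⧸ I)
  map_add' ξ η := by rw [_root_.map_add]; rfl
  map_smul' r ξ := by rw [_root_.map_smul]; rfl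

lemma evalOne_mk₀ (I : Ideal R) (f : ModuleCat.of R (R ⧸ I) ⟶ M) :
    evalOne M I (Abelian.Ext.mk₀ f) = f.hom 1 := by
  have : Abelian.Ext.linearEquiv₀ (R := R) (Abelian.Ext.mk₀ f) = f :=
    (Abelian.Ext.mk₀_bijective _ _).injective (Abelian.Ext.mk₀_linearEquiv₀_apply _)
  exact congrArg (fun g => g.hom (1 : R ⧸ I)) this

/-- The cocone defining the natural map `H^0_𝔞(M) → M`. -/
noncomputable def evCocone : Cocone (localCohomologySystem 𝔞 0 M) where
  pt := M
  ι :=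
    { app := fun j => ModuleCat.ofHom (evalOne M (𝔞 ^ j.unop.unop))
      naturality := fun j k f => by
        refine ModuleCat.hom_ext (LinearMap.ext fun ξ => ?_)
        obtain ⟨g, rfl⟩ := (Abelian.Ext.mk₀_bijective (quotPow 𝔞 j.unop.unop) M).surjective ξ
        have h : (Abelian.Ext.mk₀ (tr 𝔞 (leOfHom f.unop.unop))).comp (Abelian.Ext.mk₀ g)
          (zero_add 0) = Abelian.Ext.mk₀ (tr 𝔞 (leOfHom f.unop.unop) ≫ g) :=
            Abelian.Ext.mk₀_comp_mk₀ _ _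
        refine (congrArg (evalOne M (𝔞 ^ k.unop.unop)) h).trans ?_
        exact (evalOne_mk₀ M _ _).trans (evalOne_mk₀ M _ g).symm }

/-- The natural map `H^0_𝔞(M) → M`. -/
noncomputable def ev : LC 𝔞 0 M →ₗ[R] M :=
  (colimit.desc (localCohomologySystem 𝔞 0 M) (evCocone 𝔞 M)).hom

variable {M}

lemma ev_ι (n : ℕ) (ξ : Abelian.Ext (quotPow 𝔞 n) M 0) : ev 𝔞 M (ι 𝔞 n ξ) = evalOne M _ ξ :=
  congrArg (fun f => f.hom ξ) (colimit.ι_desc (evCocone 𝔞 M) (op (op n)))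

lemma ev_map {N : ModuleCat.{u} R} (f : M ⟶ N) (z : LC 𝔞 0 M) :
    ev 𝔞 N (map 𝔞 0 f z) = f.hom (ev 𝔞 M z) := by
  obtain ⟨n, ξ, rfl⟩ := exists_rep 𝔞 z
  obtain ⟨g, rfl⟩ := (Abelian.Ext.mk₀_bijective _ _).surjective ξ
  rw [map, post_ι, ev_ι, ev_ι, Abelian.Ext.mk₀_comp_mk₀, evalOne_mk₀, evalOne_mk₀]
  rfl

variable (M) in
lemma ev_injective : Function.Injective (ev 𝔞 M) := by
  rw [injective_iff_map_eq_zero]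
  intro z hz
  obtain ⟨n, ξ, rfl⟩ := exists_rep 𝔞 z
  obtain ⟨g, rfl⟩ := (Abelian.Ext.mk₀_bijective _ _).surjective ξ
  rw [ev_ι, evalOne_mk₀] at hz
  have : g = 0 := by
    refine ModuleCat.hom_ext (LinearMap.ext fun x => ?_)
    obtain ⟨y, rfl⟩ := Ideal.Quotient.mk_surjective x
    have : (Ideal.Quotient.mk (𝔞 ^ n) y) = y • (1 : R ⧸ 𝔞 ^ n) := by
      rw [Algebra.smul_def, mul_one]; rfl
    rw [this, map_smul, hz, smul_zero]
    rfl
  rw [this, Abelian.Ext.mk₀_zero, _root_.map_zero]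

variable (M) in
lemma range_ev : LinearMap.range (ev 𝔞 M) = powTorsion 𝔞 M := by
  ext m
  constructor
  · rintro ⟨z, rfl⟩
    obtain ⟨n, ξ, rfl⟩ := exists_rep 𝔞 z
    obtain ⟨g, rfl⟩ := (Abelian.Ext.mk₀_bijective _ _).surjective ξ
    rw [ev_ι, evalOne_mk₀]
    refine ⟨n, fun r hr => ?_⟩
    rw [← map_smul]
    have : r • (1 : R ⧸ 𝔞 ^ n) = 0 := by
      rw [Algebra.smul_def, mul_one]
      exact Ideal.Quotient.eq_zero_iff_mem.mpr hr
    rw [this, _root_.map_zero]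
  · rintro ⟨n, hn⟩
    let g : (R ⧸ 𝔞 ^ n) →ₗ[R] M := Submodule.liftQ _ (LinearMap.toSpanSingleton R M m)
      fun r hr => hn r hr
    refine ⟨ι 𝔞 n (Abelian.Ext.mk₀ (ModuleCat.ofHom g)), ?_⟩
    rw [ev_ι, evalOne_mk₀]
    exact one_smul R m

variable (M) in
/-- `H^0_𝔞(M)` is the `𝔞`-torsion submodule. -/
noncomputable def zeroEquiv : LC 𝔞 0 M ≃ₗ[R] powTorsion 𝔞 M :=
  (LinearEquiv.ofInjective (ev 𝔞 M) (ev_injective 𝔞 M)).trans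
    (LinearEquiv.ofEq _ _ (range_ev 𝔞 M))

lemma subsingleton_zero_iff : Subsingleton (LC 𝔞 0 M) ↔ powTorsion 𝔞 M = ⊥ := by
  rw [(zeroEquiv 𝔞 M).toEquiv.subsingleton_congr, Submodule.subsingleton_iff_eq_bot]

lemma map_zero_surjective_iff {N : ModuleCat.{u} R} (f : M ⟶ N) :
    Function.Surjective (map 𝔞 0 f) ↔
      ∀ y ∈ powTorsion 𝔞 N, ∃ x ∈ powTorsion 𝔞 M, f.hom x = y := by
  constructor
  · intro h y hy
    rw [← range_ev] at hy
    obtain ⟨z, rfl⟩ := hy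
    obtain ⟨w, rfl⟩ := h z
    exact ⟨ev 𝔞 M w, by rw [← range_ev]; exact ⟨w, rfl⟩, (ev_map 𝔞 f w).symm⟩
  · intro h z
    obtain ⟨x, hx, hxz⟩ := h (ev 𝔞 N z) (by rw [← range_ev]; exact ⟨z, rfl⟩)
    rw [← range_ev] at hx
    obtain ⟨w, rfl⟩ := hx
    exact ⟨w, ev_injective 𝔞 N (by rw [ev_map, hxz])⟩

section

variable {S : ShortComplex (ModuleCat.{u} R)} (hS : S.ShortExact)
include hS

/-- H^1 of the left term is the cokernel of Γ(X₂) → Γ(X₃). Together with the shift below, this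
expresses vanishing in all positive degrees through Γ alone, so it can be compared across ideals and
rings. -/
lemma subsingleton_one_iff [Injective S.X₂] :
    Subsingleton (LC 𝔞 1 S.X₁) ↔
      ∀ y ∈ powTorsion 𝔞 S.X₃, ∃ x ∈ powTorsion 𝔞 S.X₂, S.g.hom x = y := by
  rw [← map_zero_surjective_iff]
  constructor
  · intro h z
    exact exact₃ 𝔞 hS 0 z (Subsingleton.elim _ _)
  · intro h
    refine subsingleton_of_forall_eq 0 fun z => ?_
    obtain ⟨y, rfl⟩ := exact₁ 𝔞 hS 0 z (Subsingleton.elim _ _)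
    obtain ⟨x, rfl⟩ := h y
    rw [δ_map_eq_zero]

lemma subsingleton_add_two_iff [Injective S.X₂] (i : ℕ) :
    Subsingleton (LC 𝔞 (i + 2) S.X₁) ↔ Subsingleton (LC 𝔞 (i + 1) S.X₃) :=
  (δEquiv 𝔞 hS (i + 1)).symm.toEquiv.subsingleton_congr

end

end LC

end DegreeZero

open scoped Pointwise in
lemma smul_top_eq_range_lsmul {R M : Type*} [CommRing R] [AddCommGroup M] [Module R M] (r : R) :
    r • (⊤ : Submodule R M) = LinearMap.range (LinearMap.lsmul R M r) := by
  ext m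
  simp [Submodule.mem_smul_pointwise_iff_exists]

/-! ### Vanishing below a regular sequence and above the number of generators -/

section Vanishing

variable {R : Type u} [CommRing R]

lemma powTorsion_anti {𝔞 𝔟 : Ideal R} (h : 𝔞 ≤ 𝔟) (M : Type*) [AddCommGroup M] [Module R M] :
    powTorsion 𝔟 M ≤ powTorsion 𝔞 M := fun _ ⟨n, hn⟩ =>
  ⟨n, fun r hr => hn r (Ideal.pow_right_mono h n hr)⟩

lemma powTorsion_eq_of_le_radical [IsNoetherianRing R] {𝔞 𝔟 : Ideal R} (h : 𝔞 ≤ 𝔟)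
    (h' : 𝔟 ≤ 𝔞.radical) (M : Type*) [AddCommGroup M] [Module R M] :
    powTorsion 𝔞 M = powTorsion 𝔟 M := by
  refine le_antisymm ?_ (powTorsion_anti h M)
  rintro m ⟨n, hn⟩
  obtain ⟨k, hk⟩ := Ideal.exists_pow_le_of_le_radical_of_fg h' (IsNoetherian.noetherian 𝔟)
  refine ⟨k * n, fun r hr => hn r ?_⟩
  rw [pow_mul] at hr
  exact Ideal.pow_right_mono hk n hr

lemma powTorsion_sup (𝔞 𝔟 : Ideal R) (M : Type*) [AddCommGroup M] [Module R M] :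
    powTorsion (𝔞 ⊔ 𝔟) M = powTorsion 𝔞 M ⊓ powTorsion 𝔟 M := by
  refine le_antisymm (le_inf (powTorsion_anti le_sup_left M) (powTorsion_anti le_sup_right M)) ?_
  rintro m ⟨⟨n, hn⟩, ⟨k, hk⟩⟩
  refine ⟨n + k, fun r hr => ?_⟩
  obtain ⟨x, hx, y, hy, rfl⟩ := Submodule.mem_sup.mp (Ideal.sup_pow_add_le_pow_sup_pow hr)
  rw [add_smul, hn x hx, hk y hy, add_zero]

lemma mem_powTorsion_span_singleton {x : R} {M : Type*} [AddCommGroup M] [Module R M] {m : M} :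
    m ∈ powTorsion (Ideal.span {x}) M ↔ ∃ n : ℕ, x ^ n • m = 0 := by
  constructor
  · rintro ⟨n, hn⟩
    exact ⟨n, hn _ (Ideal.pow_mem_pow (Ideal.mem_span_singleton_self x) n)⟩
  · rintro ⟨n, hn⟩
    refine ⟨n, fun r hr => ?_⟩
    rw [Ideal.span_singleton_pow] at hr
    obtain ⟨c, rfl⟩ := Ideal.mem_span_singleton'.mp hr
    rw [mul_smul, hn, smul_zero]

namespace LC

variable {M N : Type u} [AddCommGroup M] [Module R M] [AddCommGroup N] [Module R N]

lemma subsingleton_of_linearEquiv (𝔞 : Ideal R) (i : ℕ) (e : M ≃ₗ[R] N)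
    [h : Subsingleton (LC 𝔞 i (ModuleCat.of R M))] :
    Subsingleton (LC 𝔞 i (ModuleCat.of R N)) :=
  (mapEquiv 𝔞 i e.toModuleIso).symm.toEquiv.subsingleton

/-- Multiplication by x is locally nilpotent on local cohomology, so it can be injective only on
zero. -/
lemma subsingleton_of_smul_injective {𝔞 : Ideal R} {x : R} (hx : x ∈ 𝔞) {i : ℕ}
    {M : ModuleCat.{u} R} (h : ∀ z : LC 𝔞 i M, x • z = 0 → z = 0) : Subsingleton (LC 𝔞 i M) := by
  refine subsingleton_of_forall_eq 0 fun z => ?_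
  obtain ⟨n, hn⟩ := exists_pow_smul_eq_zero 𝔞 hx z
  induction n with
  | zero => simpa using hn
  | succ n ih =>
    rw [pow_succ', mul_smul] at hn
    exact ih (h _ hn)

lemma subsingleton_of_bijective {𝔞 : Ideal R} {x : R} (hx : x ∈ 𝔞) (i : ℕ)
    (h : Function.Bijective fun m : M => x • m) : Subsingleton (LC 𝔞 i (ModuleCat.of R M)) := by
  refine subsingleton_of_smul_injective hx fun z hz => ?_
  let e : M ≃ₗ[R] M := LinearEquiv.ofBijective (LinearMap.lsmul R M x) h
  have he : (ModuleCat.ofHom e.toLinearMap : ModuleCat.of R M ⟶ ModuleCat.of R M) = x • 𝟙 _ := rfl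
  rw [← map_smul_id, ← he] at hz
  exact (mapEquiv 𝔞 i e.toModuleIso).map_eq_zero_iff.mp hz

section SMulSequence

/-- The short exact sequence `0 → M → M → M/xM → 0` of a nonzerodivisor. -/
lemma shortExact_lsmul {x : R} (hx : IsSMulRegular M x) :
    (LinearMap.lsmul R M x).shortComplexCoker.ShortExact :=
  LinearMap.shortExact_shortComplexCoker hx

lemma map_lsmul (𝔞 : Ideal R) (i : ℕ) (x : R) (z : LC 𝔞 i (ModuleCat.of R M)) :
    map 𝔞 i (LinearMap.lsmul R M x).shortComplexCoker.f z = x • z :=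
  map_smul_id 𝔞 x z

/-- By the long exact sequence, the kernel of x on H^(i+1)(M) is the image of H^i(M/xM). -/
lemma subsingleton_succ_of_isSMulRegular {𝔞 : Ideal R} {x : R} (hx : x ∈ 𝔞)
    (hM : IsSMulRegular M x) (i : ℕ)
    (h : Subsingleton (LC 𝔞 i (ModuleCat.of R (M ⧸ LinearMap.range (LinearMap.lsmul R M x))))) :
    Subsingleton (LC 𝔞 (i + 1) (ModuleCat.of R M)) := by
  refine subsingleton_of_smul_injective hx fun z hz => ?_
  rw [← map_lsmul] at hz
  obtain ⟨y, rfl⟩ := exact₁ 𝔞 (shortExact_lsmul hM) i z hz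
  have : y = 0 := h.elim _ _
  rw [this, _root_.map_zero]

lemma subsingleton_zero_of_isSMulRegular {𝔞 : Ideal R} {x : R} (hx : x ∈ 𝔞)
    (hM : IsSMulRegular M x) : Subsingleton (LC 𝔞 0 (ModuleCat.of R M)) := by
  refine subsingleton_of_smul_injective hx fun z hz => ?_
  have h1 : x • ev 𝔞 _ z = 0 := by rw [← map_smul, hz, _root_.map_zero]
  refine (map_eq_zero_iff _ (ev_injective 𝔞 _)).mp (hM ?_)
  simpa using h1

end SMulSequence

/-- Local cohomology vanishes below the length of a regular sequence. -/
lemma subsingleton_of_isWeaklyRegular {𝔞 : Ideal R} (rs : List R) (hrs : ∀ r ∈ rs, r ∈ 𝔞)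
    (h : RingTheory.Sequence.IsWeaklyRegular M rs) (i : ℕ) (hi : i < rs.length) :
    Subsingleton (LC 𝔞 i (ModuleCat.of R M)) := by
  induction rs generalizing M i with
  | nil => simp at hi
  | cons r rs ih =>
    rw [RingTheory.Sequence.isWeaklyRegular_cons_iff] at h
    obtain _ | i := i
    · exact subsingleton_zero_of_isSMulRegular (hrs r (by simp)) h.1
    · have h1 := ih (fun s hs => hrs s (by simp [hs])) h.2 i (by simpa using hi)
      refine subsingleton_succ_of_isSMulRegular (hrs r (by simp)) h.1 i ?_
      exact subsingleton_of_linearEquiv 𝔞 i (Submodule.quotEquivOfEq _ _ (smul_top_eq_range_lsmul r))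

/-- M embeds into its localization M_x with x-power torsion cokernel, and M_x has no local
cohomology because x acts on it bijectively. This trades a degree for x-torsion. -/
lemma subsingleton_succ_of_powTorsion_eq_bot {𝔞 : Ideal R} {x : R} (hx : x ∈ 𝔞)
    (hM : powTorsion (Ideal.span {x}) M = ⊥) (i : ℕ)
    (h : ∀ (N : Type u) [AddCommGroup N] [Module R N],
      powTorsion (Ideal.span {x}) N = ⊤ → Subsingleton (LC 𝔞 i (ModuleCat.of R N))) :
    Subsingleton (LC 𝔞 (i + 1) (ModuleCat.of R M)) := by
  let S := Submonoid.powers x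
  let f := LocalizedModule.mkLinearMap S M
  have hf : Function.Injective f := by
    rw [injective_iff_map_eq_zero]
    intro m hm
    obtain ⟨⟨_, n, rfl⟩, hn⟩ := (IsLocalizedModule.eq_zero_iff S f).mp hm
    rw [← Submodule.mem_bot R, ← hM]
    exact mem_powTorsion_span_singleton.mpr ⟨n, hn⟩
  have hbij : Function.Bijective fun m : LocalizedModule S M => x • m :=
    (Module.End.isUnit_iff _).mp
      (IsLocalizedModule.map_units f (⟨x, Submonoid.mem_powers x⟩ : S))
  have h1 := subsingleton_of_bijective hx (i + 1) hbij
  have h2 := h (LocalizedModule S M ⧸ LinearMap.range f) (by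
    refine eq_top_iff.mpr fun y _ => ?_
    obtain ⟨z, rfl⟩ := Submodule.mkQ_surjective _ y
    obtain ⟨⟨m, ⟨_, n, rfl⟩⟩, hm⟩ := IsLocalizedModule.surj S f z
    refine mem_powTorsion_span_singleton.mpr ⟨n, ?_⟩
    rw [← map_smul]
    exact (Submodule.Quotient.mk_eq_zero _).mpr ⟨m, hm.symm⟩)
  exact subsingleton₁ 𝔞 (LinearMap.shortExact_shortComplexCoker hf) i

variable [IsNoetherianRing R]

instance {I : Type u} [AddCommGroup I] [Module R I] [Module.Injective R I] :
    Injective (ModuleCat.of R I) := Module.injective_object_of_injective_module R I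

/-- Vanishing of local cohomology with respect to two ideals is equivalent for `𝔠`-torsion modules
if the two torsion functors agree on such modules. -/
lemma subsingleton_congr_of_powTorsion {𝔞 𝔟 𝔠 : Ideal R}
    (h : ∀ (M : Type u) [AddCommGroup M] [Module R M], powTorsion 𝔠 M = ⊤ →
      powTorsion 𝔞 M = powTorsion 𝔟 M) (i : ℕ) (hM : powTorsion 𝔠 M = ⊤) :
    Subsingleton (LC 𝔞 i (ModuleCat.of R M)) ↔ Subsingleton (LC 𝔟 i (ModuleCat.of R M)) := by
  induction i generalizing M with
  | zero => rw [subsingleton_zero_iff, subsingleton_zero_iff, h M hM]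
  | succ i ih =>
    obtain ⟨I, _, _, f, hI, hf, hIc⟩ := exists_injective_embedding_of_powTorsion_eq_top hM
    have hS := LinearMap.shortExact_shortComplexCoker hf
    have hinj : Injective f.shortComplexCoker.X₂ := inferInstanceAs (Injective (ModuleCat.of R I))
    have hZ : powTorsion 𝔠 (I ⧸ LinearMap.range f) = ⊤ :=
      powTorsion_eq_top_of_surjective (Submodule.mkQ_surjective _) hIc
    obtain _ | i := i
    · refine (subsingleton_one_iff 𝔞 hS).trans (Iff.trans ?_ (subsingleton_one_iff 𝔟 hS).symm)
      change (∀ y ∈ powTorsion 𝔞 (I ⧸ LinearMap.range f), ∃ x ∈ powTorsion 𝔞 I, _) ↔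
        (∀ y ∈ powTorsion 𝔟 (I ⧸ LinearMap.range f), ∃ x ∈ powTorsion 𝔟 I, _)
      rw [h I hIc, h _ hZ]
    · exact (subsingleton_add_two_iff 𝔞 hS i).trans
        ((ih hZ).trans (subsingleton_add_two_iff 𝔟 hS i).symm)

/-- Torsion modules have no higher local cohomology. -/
lemma subsingleton_of_powTorsion_eq_top {𝔞 : Ideal R} (hM : powTorsion 𝔞 M = ⊤) (i : ℕ) :
    Subsingleton (LC 𝔞 (i + 1) (ModuleCat.of R M)) :=
  (subsingleton_congr_of_powTorsion (𝔟 := ⊥) (𝔠 := 𝔞)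
    (fun M _ _ h => by rw [h, powTorsion_bot]) (i + 1) hM).mpr inferInstance

lemma subsingleton_congr_of_le_radical {𝔞 𝔟 : Ideal R} (h : 𝔞 ≤ 𝔟) (h' : 𝔟 ≤ 𝔞.radical) (i : ℕ) :
    Subsingleton (LC 𝔞 i (ModuleCat.of R M)) ↔ Subsingleton (LC 𝔟 i (ModuleCat.of R M)) :=
  subsingleton_congr_of_powTorsion (𝔠 := ⊥)
    (fun M _ _ _ => powTorsion_eq_of_le_radical h h' M) i powTorsion_bot

/-- Local cohomology vanishes above the number of generators of the ideal. -/
lemma subsingleton_span_of_card_lt (s : Finset R) (i : ℕ) (hi : s.card < i) :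
    Subsingleton (LC (Ideal.span (s : Set R)) i (ModuleCat.of R M)) := by
  classical
  induction s using Finset.induction_on generalizing M i with
  | empty =>
    obtain _ | i := i
    · simp at hi
    · rw [Finset.coe_empty, Ideal.span_empty]
      infer_instance
  | insert x s hx ih =>
    rw [Finset.card_insert_of_notMem hx] at hi
    set 𝔞 := Ideal.span ((insert x s : Finset R) : Set R) with h𝔞
    have h𝔞' : 𝔞 = Ideal.span {x} ⊔ Ideal.span (s : Set R) := by
      rw [h𝔞, Finset.coe_insert, Ideal.span_insert]
    have hx𝔞 : x ∈ 𝔞 := Ideal.subset_span (by simp)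
    -- On x-power torsion modules the torsion functors of (x, s) and of (s) coincide, so the bound
    -- for the smaller generating set applies.
    have torsion : ∀ (N : Type u) [AddCommGroup N] [Module R N],
        powTorsion (Ideal.span {x}) N = ⊤ → ∀ i, s.card < i →
          Subsingleton (LC 𝔞 i (ModuleCat.of R N)) := fun N _ _ hN i hi =>
      (subsingleton_congr_of_powTorsion (fun L _ _ hL => by
        rw [h𝔞', powTorsion_sup, hL, top_inf_eq]) i hN).mpr (ih i hi)
    obtain ⟨i, rfl⟩ : ∃ k, i = k + 1 := ⟨i - 1, by omega⟩
    -- M is an extension of an x-torsion-free module by an x-power torsion one. The torsion-free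
    -- part costs one degree, which pays for the extra generator.
    let T := powTorsion (Ideal.span {x}) M
    have h1 := torsion T powTorsion_powTorsion (i + 1) (by omega)
    have h2 : Subsingleton (LC 𝔞 (i + 1) (ModuleCat.of R (M ⧸ T))) :=
      subsingleton_succ_of_powTorsion_eq_bot hx𝔞 powTorsion_quotient_powTorsion i
        fun N _ _ hN => torsion N hN i (by omega)
    exact subsingleton₂ 𝔞 T.shortExact_shortComplex (i + 1)

end LC

end Vanishing

/-! ### Transfer of injective dimension and of Ext vanishing -/

section InjectiveDimensionAndExt

variable {R : Type u} [CommRing R]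

lemma ModuleCat.hasInjectiveDimensionLT_of_linearEquiv {M N : Type u} [AddCommGroup M] [Module R M]
    [AddCommGroup N] [Module R N] (e : M ≃ₗ[R] N) {n : ℕ}
    (h : HasInjectiveDimensionLT (ModuleCat.of R M) n) :
    HasInjectiveDimensionLT (ModuleCat.of R N) n :=
  hasInjectiveDimensionLT_of_iso e.toModuleIso n

lemma Abelian.Ext.subsingleton_of_linearEquiv {K : ModuleCat.{u} R} {M N : Type u}
    [AddCommGroup M] [Module R M] [AddCommGroup N] [Module R N] (e : M ≃ₗ[R] N) {n : ℕ}
    (h : Subsingleton (Abelian.Ext K (ModuleCat.of R M) n)) :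
    Subsingleton (Abelian.Ext K (ModuleCat.of R N) n) := by
  refine subsingleton_of_forall_eq 0 fun x => ?_
  have h1 : (x.comp (Abelian.Ext.mk₀ e.toModuleIso.inv) (add_zero n)).comp
      (Abelian.Ext.mk₀ e.toModuleIso.hom) (add_zero n) = x := by
    rw [Abelian.Ext.comp_assoc_of_third_deg_zero, Abelian.Ext.mk₀_comp_mk₀, Iso.inv_hom_id,
      Abelian.Ext.comp_mk₀_id]
  have h2 : x.comp (Abelian.Ext.mk₀ e.toModuleIso.inv) (add_zero n) = 0 := h.elim _ _
  rw [← h1, h2, Abelian.Ext.zero_comp]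

lemma LC.map_zero_injective (𝔞 : Ideal R) {M N : ModuleCat.{u} R} (f : M ⟶ N) (hf : Function.Injective f.hom) :
    Function.Injective (LC.map 𝔞 0 f) := by
  rw [injective_iff_map_eq_zero]
  intro z hz
  refine (map_eq_zero_iff _ (LC.ev_injective 𝔞 M)).mp (hf ?_)
  rw [← LC.ev_map, hz, _root_.map_zero, _root_.map_zero]

variable [IsNoetherianRing R]

namespace LC

variable {M : Type u} [AddCommGroup M] [Module R M] (𝔞 : Ideal R)

/-- If `M` has no higher local cohomology, then `H^0_𝔞(M)` inherits bounds on the injective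
dimension. -/
lemma hasInjectiveDimensionLT_zero (n : ℕ) (hM : HasInjectiveDimensionLT (ModuleCat.of R M) n)
    (h : ∀ i, Subsingleton (LC 𝔞 (i + 1) (ModuleCat.of R M))) :
    HasInjectiveDimensionLT (LC 𝔞 0 (ModuleCat.of R M)) n := by
  induction n generalizing M with
  | zero =>
    have : Subsingleton M :=
      ModuleCat.subsingleton_of_isZero (isZero_of_hasInjectiveDimensionLT_zero (ModuleCat.of R M))
    have : Subsingleton (LC 𝔞 0 (ModuleCat.of R M)) :=
      @subsingleton_of_subsingleton R _ 𝔞 0 (ModuleCat.of R M) this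
    exact (ModuleCat.isZero_of_subsingleton _).hasInjectiveDimensionLT_zero
  | succ n ih =>
    obtain _ | n := n
    · have hM' : Injective (ModuleCat.of R M) := injective_iff_hasInjectiveDimensionLT_one.mpr hM
      have : Module.Injective R M := Module.injective_module_of_injective_object R M
      have := injective_powTorsion 𝔞 M
      exact ModuleCat.hasInjectiveDimensionLT_of_linearEquiv (zeroEquiv 𝔞 (ModuleCat.of R M)).symm
        (n := 1) inferInstance
    · obtain ⟨I, _, _, f, hI, hf⟩ := exists_injective_embedding (R := R) M
      have hS := LinearMap.shortExact_shortComplexCoker hf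
      have hinj : Injective (ModuleCat.of R I) := inferInstance
      have hZ := (hS.hasInjectiveDimensionLT_X₃_iff n hinj).mpr hM
      have hZ0 := ih hZ fun i => by
        have h1 : Subsingleton (LC 𝔞 (i + 1 + 1) f.shortComplexCoker.X₁) := h (i + 1)
        have h2 : Subsingleton (LC 𝔞 (i + 1) f.shortComplexCoker.X₂) :=
          subsingleton_of_injective 𝔞 i (ModuleCat.of R I)
        exact subsingleton₃ 𝔞 hS (i + 1)
      have hI0 := ModuleCat.hasInjectiveDimensionLT_of_linearEquiv
        (zeroEquiv 𝔞 (ModuleCat.of R I)).symm (n := 1)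
          (by have := injective_powTorsion 𝔞 I; infer_instance)
      let T : ShortComplex (ModuleCat.{u} R) := ModuleCat.shortComplexOfCompEqZero
        (map 𝔞 0 f.shortComplexCoker.f) (map 𝔞 0 f.shortComplexCoker.g)
        (LinearMap.ext fun z => map_comp_eq_zero 𝔞 _ 0 z)
      -- Γ is only left exact in general; surjectivity on the right uses H^1(M) = 0.
      have hT : T.ShortExact := ModuleCat.shortComplex_shortExact _
        (fun z => ⟨exact₂ 𝔞 hS 0 z, by rintro ⟨y, rfl⟩; exact map_comp_eq_zero 𝔞 _ 0 y⟩)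
        (map_zero_injective 𝔞 _ hf) fun z => exact₃ 𝔞 hS 0 z ((h 0).elim _ _)
      exact hT.hasInjectiveDimensionLT_X₁ (n + 1) hZ0
        (hasInjectiveDimensionLT_of_ge (LC 𝔞 0 (ModuleCat.of R I)) 1 _ (by omega))

/-- The middle term is acyclic for local cohomology even in degree 0, so every connecting map H^i(Z)
→ H^(i+1)(M) is an isomorphism. -/
lemma exists_shortExact_of_powTorsion_eq_bot (h : powTorsion 𝔞 M = ⊥) :
    ∃ (I Z : Type u) (_ : AddCommGroup I) (_ : Module R I) (_ : AddCommGroup Z) (_ : Module R Z)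
      (f : M →ₗ[R] I) (g : I →ₗ[R] Z) (w : g ∘ₗ f = 0),
      (ModuleCat.shortComplexOfCompEqZero f g w).ShortExact ∧ Injective (ModuleCat.of R I) ∧
        (∀ i, Subsingleton (LC 𝔞 i (ModuleCat.of R I))) := by
  obtain ⟨I, _, _, f, hI, hf, hI0⟩ := exists_injective_embedding_of_powTorsion_eq_bot h
  refine ⟨I, I ⧸ LinearMap.range f, _, _, inferInstance, inferInstance, f, f.range.mkQ, _,
    LinearMap.shortExact_shortComplexCoker hf, inferInstance, fun i => ?_⟩
  obtain _ | i := i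
  · exact (subsingleton_zero_iff 𝔞).mpr hI0
  · infer_instance

/-- If local cohomology is concentrated in degree `j`, then `H^j_𝔞(M)` inherits bounds on the
injective dimension. -/
lemma hasInjectiveDimensionLT_of_concentrated (j n : ℕ)
    (hM : HasInjectiveDimensionLT (ModuleCat.of R M) (n + 1))
    (h : ∀ i, i ≠ j → Subsingleton (LC 𝔞 i (ModuleCat.of R M))) :
    HasInjectiveDimensionLT (LC 𝔞 j (ModuleCat.of R M)) (n + 1) := by
  induction j generalizing M with
  | zero => exact hasInjectiveDimensionLT_zero 𝔞 (n + 1) hM fun i => h _ (by omega)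
  | succ j ih =>
    obtain ⟨I, Z, _, _, _, _, f, g, w, hS, hI, hI0⟩ := exists_shortExact_of_powTorsion_eq_bot 𝔞
      ((subsingleton_zero_iff 𝔞).mp (h 0 (by omega)))
    have h2 : ∀ i, Subsingleton (LC 𝔞 i (ModuleCat.shortComplexOfCompEqZero f g w).X₂) := hI0
    have hZ := ih (M := Z)
      -- The bound is kept as n + 1 ≥ 1, so that it also covers the injective middle term.
      (hS.hasInjectiveDimensionLT_X₃ (n + 1)
        (hasInjectiveDimensionLT_of_ge (ModuleCat.of R I) 1 _ (by omega))
        (hasInjectiveDimensionLT_of_ge (ModuleCat.of R M) (n + 1) _ (by omega)))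
      fun i hi => by
        have h1 : Subsingleton (LC 𝔞 (i + 1) (ModuleCat.shortComplexOfCompEqZero f g w).X₁) :=
          h (i + 1) (by omega)
        exact subsingleton₃ 𝔞 hS i
    exact hasInjectiveDimensionLT_of_iso (δEquiv 𝔞 hS j).toModuleIso (n + 1)

variable {𝔞}
variable {K : Type u} [AddCommGroup K] [Module R K]

/-- If all local cohomology of `M` vanishes, then so does `Ext` from modules killed by `𝔞`. -/
lemma ext_subsingleton_of_forall_subsingleton (hK : 𝔞 ≤ Module.annihilator R K)
    (h : ∀ i, Subsingleton (LC 𝔞 i (ModuleCat.of R M))) (p : ℕ) :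
    Subsingleton (Abelian.Ext (ModuleCat.of R K) (ModuleCat.of R M) p) := by
  have h0 := (subsingleton_zero_iff 𝔞).mp (h 0)
  induction p generalizing M with
  | zero =>
    refine subsingleton_of_forall_eq 0 fun ξ => ?_
    obtain ⟨g, rfl⟩ := (Abelian.Ext.mk₀_bijective _ _).surjective ξ
    have : g = 0 := by
      refine ModuleCat.hom_ext (LinearMap.ext fun x => ?_)
      have hx : x ∈ powTorsion 𝔞 K := by
        rw [powTorsion_eq_top_of_le_annihilator hK]; exact Submodule.mem_top
      have := map_mem_powTorsion g.hom hx
      exact (Submodule.mem_bot R).mp (h0 ▸ this)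
    rw [this, Abelian.Ext.mk₀_zero]
  | succ p ih =>
    obtain ⟨I, Z, _, _, _, _, f, g, w, hS, hI, hI0⟩ := exists_shortExact_of_powTorsion_eq_bot 𝔞 h0
    have h2 : ∀ i, Subsingleton (LC 𝔞 i (ModuleCat.shortComplexOfCompEqZero f g w).X₂) := hI0
    have hZ0 : ∀ i, Subsingleton (LC 𝔞 i (ModuleCat.of R Z)) := fun i => by
      have h1 : Subsingleton (LC 𝔞 (i + 1) (ModuleCat.shortComplexOfCompEqZero f g w).X₁) :=
        h (i + 1)
      exact subsingleton₃ 𝔞 hS i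
    have hZ := ih hZ0 ((subsingleton_zero_iff 𝔞).mp (hZ0 0))
    refine subsingleton_of_forall_eq 0 fun ξ => ?_
    obtain ⟨y, rfl⟩ := Abelian.Ext.covariant_sequence_exact₁ _ hS ξ
      (Abelian.Ext.eq_zero_of_injective (I := ModuleCat.of R I) _) rfl
    have : y = 0 := hZ.elim _ _
    rw [this, Abelian.Ext.zero_comp]

/-- If local cohomology is concentrated in degree `j`, then the vanishing of
`Ext^p(K, H^j_𝔞(M))` for large `p` implies that of `Ext^p(K, M)`. -/
lemma ext_subsingleton_of_concentrated (hK : 𝔞 ≤ Module.annihilator R K) (j t : ℕ)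
    (h : ∀ i, i ≠ j → Subsingleton (LC 𝔞 i (ModuleCat.of R M)))
    (ht : ∀ p, t ≤ p → Subsingleton
      (Abelian.Ext (ModuleCat.of R K) (LC 𝔞 j (ModuleCat.of R M)) p))
    (p : ℕ) (hp : t + j ≤ p) :
    Subsingleton (Abelian.Ext (ModuleCat.of R K) (ModuleCat.of R M) p) := by
  induction j generalizing M p with
  | zero =>
    let T := powTorsion 𝔞 M
    have h1 : Subsingleton (Abelian.Ext (ModuleCat.of R K) (ModuleCat.of R T) p) :=
      Abelian.Ext.subsingleton_of_linearEquiv (zeroEquiv 𝔞 (ModuleCat.of R M)) (ht p hp)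
    -- M/Γ(M) is torsion-free, and its higher cohomology is squeezed between that of M and that of
    -- the torsion module Γ(M).
    have h2 : ∀ i, Subsingleton (LC 𝔞 i (ModuleCat.of R (M ⧸ T))) := fun i => by
      obtain _ | i := i
      · exact (subsingleton_zero_iff 𝔞).mpr powTorsion_quotient_powTorsion
      · have h3 : Subsingleton (LC 𝔞 (i + 1) T.shortComplex.X₂) := h (i + 1) (by omega)
        have h4 : Subsingleton (LC 𝔞 (i + 1 + 1) T.shortComplex.X₁) :=
          subsingleton_of_powTorsion_eq_top powTorsion_powTorsion (i + 1)
        exact subsingleton₃ 𝔞 T.shortExact_shortComplex (i + 1)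
    have h3 := ext_subsingleton_of_forall_subsingleton hK h2 p
    refine subsingleton_of_forall_eq 0 fun ξ => ?_
    obtain ⟨y, rfl⟩ := Abelian.Ext.covariant_sequence_exact₂ _ T.shortExact_shortComplex ξ
      (h3.elim _ _)
    have : y = 0 := h1.elim _ _
    rw [this, Abelian.Ext.zero_comp]
  | succ j ih =>
    obtain ⟨I, Z, _, _, _, _, f, g, w, hS, hI, hI0⟩ := exists_shortExact_of_powTorsion_eq_bot 𝔞
      ((subsingleton_zero_iff 𝔞).mp (h 0 (by omega)))
    have h2 : ∀ i, Subsingleton (LC 𝔞 i (ModuleCat.shortComplexOfCompEqZero f g w).X₂) := hI0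
    obtain ⟨p, rfl⟩ : ∃ q, p = q + 1 := ⟨p - 1, by omega⟩
    have hZ := ih (M := Z) (fun i hi => by
        have h1 : Subsingleton (LC 𝔞 (i + 1) (ModuleCat.shortComplexOfCompEqZero f g w).X₁) :=
          h (i + 1) (by omega)
        exact subsingleton₃ 𝔞 hS i)
      (fun q hq => Abelian.Ext.subsingleton_of_linearEquiv (δEquiv 𝔞 hS j).symm (ht q hq))
      p (by omega)
    refine subsingleton_of_forall_eq 0 fun ξ => ?_
    obtain ⟨y, rfl⟩ := Abelian.Ext.covariant_sequence_exact₁ _ hS ξ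
      (Abelian.Ext.eq_zero_of_injective (I := ModuleCat.of R I) _) rfl
    have : y = 0 := hZ.elim _ _
    rw [this, Abelian.Ext.zero_comp]

end LC

end InjectiveDimensionAndExt

/-! ### Local cohomology vanishing under localization -/

section LocalizationTransfer

variable {R : Type u} [CommRing R] {𝔞 : Ideal R} (S : Submonoid R)

lemma LocalizedModule.mk_mem_powTorsion {M : Type u} [AddCommGroup M] [Module R M] {m : M}
    (hm : m ∈ powTorsion 𝔞 M) (s : S) :
    LocalizedModule.mk m s ∈
      powTorsion (𝔞.map (algebraMap R (Localization S))) (LocalizedModule S M) := by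
  obtain ⟨n, hn⟩ := hm
  refine ⟨n, fun a ha => ?_⟩
  rw [← Ideal.map_pow] at ha
  have hle : (𝔞 ^ n).map (algebraMap R (Localization S)) ≤
      LinearMap.ker (LinearMap.toSpanSingleton (Localization S) _ (LocalizedModule.mk m s)) := by
    rw [Ideal.map_le_iff_le_comap]
    intro r hr
    rw [Ideal.mem_comap, LinearMap.mem_ker, LinearMap.toSpanSingleton_apply, algebraMap_smul,
      LocalizedModule.smul'_mk, hn r hr, LocalizedModule.zero_mk]
  exact hle ha

variable [IsNoetherianRing R]

/-- Since 𝔞^n is finitely generated, one denominator u works for all of its elements: 𝔞^n kills u m,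
and u m / (u s) is the given fraction. -/
lemma LocalizedModule.exists_mk_of_mem_powTorsion {M : Type u} [AddCommGroup M] [Module R M]
    {y : LocalizedModule S M}
    (hy : y ∈ powTorsion (𝔞.map (algebraMap R (Localization S))) (LocalizedModule S M)) :
    ∃ m ∈ powTorsion 𝔞 M, ∃ s : S, LocalizedModule.mk m s = y := by
  obtain ⟨n, hn⟩ := hy
  induction y using LocalizedModule.induction_on with | _ m s
  have key : ∀ J : Ideal R, J ≤ 𝔞 ^ n → ∃ u : S, ∀ r ∈ J, u • r • m = 0 := by
    intro J hJ
    induction J, IsNoetherian.noetherian J using Submodule.fg_induction with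
    | singleton x =>
      have hx : x ∈ 𝔞 ^ n := hJ (Submodule.mem_span_singleton_self x)
      have h1 := hn (algebraMap R _ x) (by
        rw [← Ideal.map_pow]; exact Ideal.mem_map_of_mem _ hx)
      rw [algebraMap_smul, LocalizedModule.smul'_mk, ← LocalizedModule.zero_mk s,
        LocalizedModule.mk_eq] at h1
      obtain ⟨u, hu⟩ := h1
      refine ⟨u * s, fun r hr => ?_⟩
      obtain ⟨c, rfl⟩ := Submodule.mem_span_singleton.mp hr
      rw [smul_zero, smul_zero] at hu
      rw [smul_eq_mul, mul_smul c x, smul_comm (u * s) c, mul_smul, hu, smul_zero]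
    | sup J₁ J₂ h₁ h₂ ih₁ ih₂ =>
      obtain ⟨u₁, hu₁⟩ := ih₁ (le_sup_left.trans hJ)
      obtain ⟨u₂, hu₂⟩ := ih₂ (le_sup_right.trans hJ)
      refine ⟨u₁ * u₂, fun r hr => ?_⟩
      obtain ⟨r₁, hr₁, r₂, hr₂, rfl⟩ := Submodule.mem_sup.mp hr
      rw [add_smul, smul_add, mul_smul u₁ u₂ (r₂ • m), hu₂ r₂ hr₂, smul_zero, mul_comm, mul_smul,
        hu₁ r₁ hr₁, smul_zero, add_zero]
  obtain ⟨u, hu⟩ := key _ le_rfl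
  exact ⟨u • m, ⟨n, fun r hr => by rw [smul_comm]; exact hu r hr⟩, u * s,
    LocalizedModule.mk_cancel_common_left u s m⟩

/-- Over a Noetherian ring localization preserves exactness, injectives and torsion submodules, so
the descriptions of vanishing by Γ and by cosyzygies transfer step by step. -/
lemma LC.subsingleton_localizedModule (i : ℕ) {M : Type u} [AddCommGroup M] [Module R M]
    (h : Subsingleton (LC 𝔞 i (ModuleCat.of R M))) :
    Subsingleton (LC (𝔞.map (algebraMap R (Localization S))) i
      (ModuleCat.of (Localization S) (LocalizedModule S M))) := by
  induction i generalizing M with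
  | zero =>
    rw [subsingleton_zero_iff] at h ⊢
    refine eq_bot_iff.mpr fun y hy => ?_
    obtain ⟨m, hm, s, rfl⟩ := LocalizedModule.exists_mk_of_mem_powTorsion S hy
    have : m = 0 := (Submodule.mem_bot R).mp (h ▸ hm)
    rw [this, LocalizedModule.zero_mk]
    exact Submodule.zero_mem _
  | succ i ih =>
    obtain ⟨I, _, _, f, hI, hf⟩ := exists_injective_embedding (R := R) M
    have hT := LinearMap.shortExact_shortComplexCoker hf
    have hinj : Injective f.shortComplexCoker.X₂ := inferInstanceAs (Injective (ModuleCat.of R I))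
    let g := f.range.mkQ
    let f' := LocalizedModule.map S f
    let g' := LocalizedModule.map S g
    have hex : Function.Exact f' g' := LocalizedModule.map_exact S f g f.exact_map_mkQ_range
    let T' : ShortComplex (ModuleCat.{u} (Localization S)) :=
      ModuleCat.shortComplexOfCompEqZero f' g' hex.linearMap_comp_eq_zero
    have hT' : T'.ShortExact := ModuleCat.shortComplex_shortExact T' hex
      (LocalizedModule.map_injective S f hf)
      (LocalizedModule.map_surjective S g f.range.mkQ_surjective)
    have hI' : Module.Injective (Localization S) (LocalizedModule S I) :=
      Module.injective_of_isLocalizedModule S (LocalizedModule.mkLinearMap S I)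
    have hinj' : Injective T'.X₂ :=
      inferInstanceAs (Injective (ModuleCat.of (Localization S) (LocalizedModule S I)))
    obtain _ | i := i
    · have h1 := (subsingleton_one_iff 𝔞 hT).mp h
      refine (subsingleton_one_iff _ hT').mpr fun y hy => ?_
      obtain ⟨z, hz, s, rfl⟩ := LocalizedModule.exists_mk_of_mem_powTorsion S hy
      obtain ⟨x, hx, rfl⟩ := h1 z hz
      exact ⟨_, LocalizedModule.mk_mem_powTorsion S hx s, LocalizedModule.map_mk S g x s⟩
    · exact (subsingleton_add_two_iff _ hT' i).mpr
        (ih (M := I ⧸ LinearMap.range f) ((subsingleton_add_two_iff 𝔞 hT i).mp h))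

end LocalizationTransfer

/-! ### Induction along prime filtrations -/

section PrimeInduction

variable {R : Type u} [CommRing R] [IsNoetherianRing R]

/-- A class of modules that contains the zero modules and is closed under isomorphisms and
extensions contains every finite module annihilated by `J` as soon as it contains the quotients by
the primes containing `J`. -/
lemma Module.Finite.induction_of_le_annihilator (J : Ideal R)
    {P : (N : Type u) → [AddCommGroup N] → [Module R N] → Prop}
    (subsingleton : ∀ (N : Type u) [AddCommGroup N] [Module R N] [Subsingleton N], P N)
    (equiv : ∀ (N N' : Type u) [AddCommGroup N] [Module R N] [AddCommGroup N'] [Module R N'],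
      (N ≃ₗ[R] N') → P N → P N')
    (exact : ∀ (N₁ N₂ N₃ : Type u) [AddCommGroup N₁] [Module R N₁] [AddCommGroup N₂] [Module R N₂]
      [AddCommGroup N₃] [Module R N₃] (f : N₁ →ₗ[R] N₂) (g : N₂ →ₗ[R] N₃),
      Function.Injective f → Function.Surjective g → Function.Exact f g → P N₁ → P N₃ → P N₂)
    (quotient : ∀ q : Ideal R, q.IsPrime → J ≤ q → P (R ⧸ q))
    (N : Type u) [AddCommGroup N] [Module R N] [hN : Module.Finite R N]
    (hJ : J ≤ Module.annihilator R N) : P N := by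
  induction hN using IsNoetherianRing.induction_on_isQuotientEquivQuotientPrime R with
  | subsingleton N => exact subsingleton N
  | quotient N p e =>
    refine equiv _ _ e.symm (quotient p.1 p.2 ?_)
    rw [← Ideal.annihilator_quotient (I := p.1), ← e.annihilator_eq]
    exact hJ
  | exact N₁ N₂ N₃ f g hf hg hfg h₁ h₃ =>
    exact exact N₁ N₂ N₃ f g hf hg hfg (h₁ (hJ.trans (f.annihilator_le_of_injective hf)))
      (h₃ (hJ.trans (g.annihilator_le_of_surjective hg)))

/-- Noetherian induction for classes of modules closed under isomorphisms and extensions. -/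
lemma Module.Finite.induction_of_lt_annihilator
    {P : (N : Type u) → [AddCommGroup N] → [Module R N] → Prop}
    (subsingleton : ∀ (N : Type u) [AddCommGroup N] [Module R N] [Subsingleton N], P N)
    (equiv : ∀ (N N' : Type u) [AddCommGroup N] [Module R N] [AddCommGroup N'] [Module R N'],
      (N ≃ₗ[R] N') → P N → P N')
    (exact : ∀ (N₁ N₂ N₃ : Type u) [AddCommGroup N₁] [Module R N₁] [AddCommGroup N₂] [Module R N₂]
      [AddCommGroup N₃] [Module R N₃] (f : N₁ →ₗ[R] N₂) (g : N₂ →ₗ[R] N₃),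
      Function.Injective f → Function.Surjective g → Function.Exact f g → P N₁ → P N₃ → P N₂)
    (quotient : ∀ q : Ideal R, q.IsPrime →
      (∀ (N : Type u) [AddCommGroup N] [Module R N] [Module.Finite R N],
        q < Module.annihilator R N → P N) → P (R ⧸ q))
    (N : Type u) [AddCommGroup N] [Module R N] [Module.Finite R N] : P N := by
  refine Module.Finite.induction_of_le_annihilator (⊥ : Ideal R) subsingleton equiv exact ?_ N
    bot_le
  intro q
  induction q using WellFoundedGT.induction with
  | ind q ih =>
    intro hq _
    -- Every prime containing the annihilator of N is strictly larger than q, so the ascending chain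
    -- condition supplies the hypothesis.
    refine quotient q hq fun N _ _ _ hN =>
      Module.Finite.induction_of_le_annihilator _ subsingleton equiv exact ?_ N le_rfl
    exact fun q' hq' hle => ih q' (hN.trans_le hle) hq' bot_le

end PrimeInduction

/-! ### Ext from the residue field controls injective dimension -/

section Bass

variable {R : Type u} [CommRing R]

lemma Abelian.Ext.subsingleton_of_linearEquiv_left {M : ModuleCat.{u} R} {K L : Type u}
    [AddCommGroup K] [Module R K] [AddCommGroup L] [Module R L] (e : K ≃ₗ[R] L) {n : ℕ}
    (h : Subsingleton (Abelian.Ext (ModuleCat.of R K) M n)) :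
    Subsingleton (Abelian.Ext (ModuleCat.of R L) M n) := by
  refine subsingleton_of_forall_eq 0 fun x => ?_
  have h1 : (Abelian.Ext.mk₀ e.toModuleIso.inv).comp
      ((Abelian.Ext.mk₀ e.toModuleIso.hom).comp x (zero_add n)) (zero_add n) = x := by
    rw [Abelian.Ext.mk₀_comp_mk₀_assoc, Iso.inv_hom_id, Abelian.Ext.mk₀_id_comp]
  have h2 : (Abelian.Ext.mk₀ e.toModuleIso.hom).comp x (zero_add n) = 0 := h.elim _ _
  rw [← h1, h2, Abelian.Ext.comp_zero]

lemma LinearMap.mem_annihilator_quotient_range_lsmul {M : Type*} [AddCommGroup M] [Module R M]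
    (x : R) : x ∈ Module.annihilator R (M ⧸ LinearMap.range (LinearMap.lsmul R M x)) := by
  rw [Module.mem_annihilator]
  intro y
  obtain ⟨m, rfl⟩ := Submodule.mkQ_surjective _ y
  rw [← map_smul]
  exact (Submodule.Quotient.mk_eq_zero _).mpr ⟨m, rfl⟩

lemma Ideal.Quotient.isSMulRegular_of_notMem {q : Ideal R} [q.IsPrime] {x : R} (hx : x ∉ q) :
    IsSMulRegular (R ⧸ q) x := by
  rw [isSMulRegular_iff_right_eq_zero_of_smul]
  intro y hy
  obtain ⟨r, rfl⟩ := Ideal.Quotient.mk_surjective y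
  rw [Algebra.smul_def, Ideal.Quotient.algebraMap_eq, ← map_mul, Ideal.Quotient.eq_zero_iff_mem]
    at hy
  exact Ideal.Quotient.eq_zero_iff_mem.mpr ((Ideal.IsPrime.mem_or_mem ‹_› hy).resolve_left hx)

lemma Ideal.Quotient.lt_annihilator_quotient_range_lsmul {q : Ideal R} {x : R} (hx : x ∉ q) :
    q < Module.annihilator R ((R ⧸ q) ⧸ LinearMap.range (LinearMap.lsmul R (R ⧸ q) x)) := by
  refine lt_of_le_of_ne ?_ fun h => hx (h ▸ LinearMap.mem_annihilator_quotient_range_lsmul x)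
  refine le_trans ?_ ((Submodule.mkQ _).annihilator_le_of_surjective (Submodule.mkQ_surjective _))
  rw [Ideal.annihilator_quotient]

/-- For n = 0 this is Baer's criterion: Ext^1(R/I, M) contains the obstruction to extending a map I
→ M to R. A cosyzygy lowers the Ext degree by one. -/
lemma ModuleCat.hasInjectiveDimensionLT_of_ext_quotient (n : ℕ) {M : Type u} [AddCommGroup M]
    [Module R M] (h : ∀ I : Ideal R,
      Subsingleton (Abelian.Ext (ModuleCat.of R (R ⧸ I)) (ModuleCat.of R M) (n + 1))) :
    HasInjectiveDimensionLT (ModuleCat.of R M) (n + 1) := by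
  induction n generalizing M with
  | zero =>
    have : Module.Injective R M := by
      refine Module.Baer.injective fun I g => ?_
      obtain ⟨y, hy⟩ := Abelian.Ext.contravariant_sequence_exact₁
        (Submodule.shortExact_shortComplex I) (ModuleCat.of R M)
        (Abelian.Ext.mk₀ (ModuleCat.ofHom g)) (n₁ := 1) rfl ((h I).elim _ _)
      obtain ⟨f, rfl⟩ := (Abelian.Ext.mk₀_bijective _ _).surjective y
      rw [Abelian.Ext.mk₀_comp_mk₀] at hy
      have h1 := (Abelian.Ext.mk₀_bijective _ _).injective hy
      exact ⟨f.hom, fun x hx => congrArg (fun φ => φ.hom (⟨x, hx⟩ : I)) h1⟩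
    have : Injective (ModuleCat.of R M) := Module.injective_object_of_injective_module R M
    infer_instance
  | succ n ih =>
    obtain ⟨I, _, _, f, hI, hf⟩ := exists_injective_embedding (R := R) M
    have hS := LinearMap.shortExact_shortComplexCoker hf
    have hinj : Injective (ModuleCat.of R I) := Module.injective_object_of_injective_module R I
    refine (hS.hasInjectiveDimensionLT_X₃_iff n hinj).mp (ih fun J => ?_)
    refine subsingleton_of_forall_eq 0 fun ξ => ?_
    obtain ⟨y, rfl⟩ := Abelian.Ext.covariant_sequence_exact₃ _ hS ξ rfl ((h J).elim _ _)
    have : y = 0 := Abelian.Ext.eq_zero_of_injective (I := ModuleCat.of R I) _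
    rw [this, Abelian.Ext.zero_comp]

variable [IsNoetherianRing R]

/-- If `Ext^p(k, M)` vanishes for large `p`, then so does `Ext^p(N, M)` for all finite `N`. -/
lemma Abelian.Ext.subsingleton_of_residueField [IsLocalRing R] {M : ModuleCat.{u} R}
    [Module.Finite R M] (t : ℕ)
    (h : ∀ p, t ≤ p → Subsingleton
      (Abelian.Ext (ModuleCat.of R (R ⧸ IsLocalRing.maximalIdeal R)) M p))
    (N : Type u) [AddCommGroup N] [Module R N] [Module.Finite R N] :
    ∀ p, t ≤ p → Subsingleton (Abelian.Ext (ModuleCat.of R N) M p) := by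
  refine Module.Finite.induction_of_lt_annihilator (P := fun N [AddCommGroup N] [Module R N] => ∀ p, t ≤ p →
    Subsingleton (Abelian.Ext (ModuleCat.of R N) M p)) ?_ ?_ ?_ ?_ N
  · intro N _ _ _
    exact fun p _ => subsingleton_of_forall_eq 0 fun x => by
      rw [← Abelian.Ext.mk₀_id_comp x,
        (ModuleCat.isZero_of_subsingleton (ModuleCat.of R N)).eq_of_src (𝟙 _) 0,
        Abelian.Ext.mk₀_zero, Abelian.Ext.zero_comp]
  · exact fun N N' _ _ _ _ e hN p hp => Abelian.Ext.subsingleton_of_linearEquiv_left e (hN p hp)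
  · intro N₁ N₂ N₃ _ _ _ _ _ _ f g hf hg hfg h₁ h₃ p hp
    have hS : (ModuleCat.shortComplexOfCompEqZero f g hfg.linearMap_comp_eq_zero).ShortExact :=
      ModuleCat.shortComplex_shortExact _ hfg hf hg
    refine subsingleton_of_forall_eq 0 fun x => ?_
    obtain ⟨y, rfl⟩ := Abelian.Ext.contravariant_sequence_exact₂ hS M x ((h₁ p hp).elim _ _)
    have : y = 0 := (h₃ p hp).elim _ _
    rw [this, Abelian.Ext.comp_zero]
  · intro q hq ih p hp
    by_cases hqm : q = IsLocalRing.maximalIdeal R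
    · subst hqm
      exact h p hp
    obtain ⟨x, hxm, hxq⟩ := SetLike.exists_of_lt
      (lt_of_le_of_ne (IsLocalRing.le_maximalIdeal hq.ne_top) hqm)
    have hreg := Ideal.Quotient.isSMulRegular_of_notMem hxq
    have hS := LC.shortExact_lsmul hreg
    have hC := ih _ (Ideal.Quotient.lt_annihilator_quotient_range_lsmul hxq) (p + 1) (by omega)
    -- Multiplication by x on R/q has a cokernel with larger annihilator, whose Ext^(p+1) vanishes
    -- by induction. Hence x is surjective on the finite module Ext^p(R/q, M), and Nakayama applies.
    have key : ∀ y : Abelian.Ext (ModuleCat.of R (R ⧸ q)) M p, ∃ z, x • z = y := fun y => by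
      obtain ⟨z, hz⟩ := Abelian.Ext.contravariant_sequence_exact₁ hS M y (add_comm 1 p)
        (hC.elim _ _)
      refine ⟨z, Eq.trans ?_ hz⟩
      have : (LinearMap.lsmul R (R ⧸ q) x).shortComplexCoker.f = x • 𝟙 (ModuleCat.of R (R ⧸ q)) :=
        rfl
      refine Eq.trans ?_ (congrArg (fun f => (Abelian.Ext.mk₀ f).comp z (zero_add p)) this).symm
      simp only [Abelian.Ext.mk₀_smul, Abelian.Ext.smul_comp, Abelian.Ext.mk₀_id_comp]
    have hfin : Module.Finite R (Abelian.Ext (ModuleCat.of R (R ⧸ q)) M p) := inferInstance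
    have hbot : (⊤ : Submodule R (Abelian.Ext (ModuleCat.of R (R ⧸ q)) M p)) = ⊥ := by
      refine Submodule.eq_bot_of_le_smul_of_le_jacobson_bot (IsLocalRing.maximalIdeal R) _
        hfin.fg_top (fun y _ => ?_) (IsLocalRing.maximalIdeal_le_jacobson _)
      obtain ⟨z, rfl⟩ := key y
      exact Submodule.smul_mem_smul hxm Submodule.mem_top
    exact (Submodule.subsingleton_iff R).mp (subsingleton_of_bot_eq_top hbot.symm)

/-- Finiteness of the injective dimension is detected by `Ext` from the residue field. -/
lemma ModuleCat.hasInjectiveDimensionLT_of_ext_residueField [IsLocalRing R] {M : Type u}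
    [AddCommGroup M] [Module R M] [Module.Finite R M] (t : ℕ)
    (h : ∀ p, t ≤ p → Subsingleton
      (Abelian.Ext (ModuleCat.of R (R ⧸ IsLocalRing.maximalIdeal R)) (ModuleCat.of R M) p)) :
    HasInjectiveDimensionLT (ModuleCat.of R M) (t + 1) :=
  hasInjectiveDimensionLT_of_ext_quotient t fun I =>
    Abelian.Ext.subsingleton_of_residueField t h (R ⧸ I) (t + 1) (by omega)

/-- Devissage gives Hom(M, M) = 0, so the identity of M is zero. -/
lemma subsingleton_of_ext_residueField [IsLocalRing R] {M : Type u}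
    [AddCommGroup M] [Module R M] [Module.Finite R M]
    (h : ∀ p, Subsingleton
      (Abelian.Ext (ModuleCat.of R (R ⧸ IsLocalRing.maximalIdeal R)) (ModuleCat.of R M) p)) :
    Subsingleton M := by
  have h0 := Abelian.Ext.subsingleton_of_residueField 0 (fun p _ => h p) M 0 le_rfl
  have h1 : 𝟙 (ModuleCat.of R M) = 0 :=
    (Abelian.Ext.mk₀_bijective _ _).injective (h0.elim _ _)
  exact subsingleton_of_forall_eq 0 fun m => congrArg (fun φ => φ.hom m) h1

end Bass

/-! ### An Artinian criterion and elements acting surjectively -/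

section Artinian

variable {R : Type*} [CommRing R] {H : Type*} [AddCommGroup H] [Module R H]

/-- The submodule `x ^ n L ∩ (0 : x)`. -/
def Submodule.socleLayer (x : R) (n : ℕ) (L : Submodule R H) : Submodule R H :=
  L.map (LinearMap.lsmul R H (x ^ n)) ⊓ LinearMap.ker (LinearMap.lsmul R H x)

lemma Submodule.socleLayer_mono (x : R) (n : ℕ) {K L : Submodule R H} (h : K ≤ L) :
    K.socleLayer x n ≤ L.socleLayer x n :=
  inf_le_inf_right _ (Submodule.map_mono h)

lemma Submodule.socleLayer_antitone (x : R) (L : Submodule R H) {n k : ℕ} (h : n ≤ k) :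
    L.socleLayer x k ≤ L.socleLayer x n := by
  refine inf_le_inf_right _ ?_
  rintro _ ⟨l, hl, rfl⟩
  refine ⟨x ^ (k - n) • l, L.smul_mem _ hl, ?_⟩
  rw [LinearMap.lsmul_apply, LinearMap.lsmul_apply, ← mul_smul, ← pow_add, Nat.add_sub_cancel' h]

/-- Induct on the power of x killing l ∈ L. If x^(n+1) l = 0, then x^n l lies in the n-th layer, so
x^n l = x^n l' with l' ∈ K, and l - l' is killed by x^n. -/
lemma Submodule.le_of_socleLayer_le {x : R} (hx : ∀ y : H, ∃ n : ℕ, x ^ n • y = 0)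
    {K L : Submodule R H} (hKL : K ≤ L) (h : ∀ n, L.socleLayer x n ≤ K.socleLayer x n) :
    L ≤ K := by
  have key : ∀ (n : ℕ), ∀ l ∈ L, x ^ n • l = 0 → l ∈ K := by
    intro n
    induction n with
    | zero =>
      intro l _ h0
      rw [pow_zero, one_smul] at h0
      exact h0 ▸ K.zero_mem
    | succ n ih =>
      intro l hl h0
      obtain ⟨⟨l', hl', h1⟩, -⟩ := h n ⟨⟨l, hl, rfl⟩, by
        rw [SetLike.mem_coe, LinearMap.mem_ker, LinearMap.lsmul_apply, LinearMap.lsmul_apply, ← mul_smul,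
          ← pow_succ', h0]⟩
      rw [LinearMap.lsmul_apply, LinearMap.lsmul_apply] at h1
      have := ih (l - l') (L.sub_mem hl (hKL hl')) (by rw [smul_sub, h1, sub_self])
      simpa using K.add_mem this hl'
  intro l hl
  obtain ⟨n, hn⟩ := hx l
  exact key n l hl hn

/-- A module all of whose elements are killed by powers of `x` is Artinian as soon as the kernel
of `x` is Artinian. -/
lemma isArtinian_of_isArtinian_ker_lsmul {x : R} (hx : ∀ y : H, ∃ n : ℕ, x ^ n • y = 0)
    [hK : IsArtinian R (LinearMap.ker (LinearMap.lsmul R H x))] : IsArtinian R H := by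
  have stab : ∀ g : ℕ → Submodule R H, Antitone g →
      (∀ n, g n ≤ LinearMap.ker (LinearMap.lsmul R H x)) → ∃ n, ∀ k, n ≤ k → g n = g k := by
    intro g hg hle
    obtain ⟨n, hn⟩ := monotone_stabilizes_iff_artinian.mpr hK
      ⟨fun k => OrderDual.toDual ((g k).submoduleOf _), fun i j hij =>
        Submodule.comap_mono (hg hij)⟩
    refine ⟨n, fun k hk => ?_⟩
    have h1 : (g n).submoduleOf _ = (g k).submoduleOf _ := hn k hk
    have h2 := congrArg (Submodule.map (Submodule.subtype _)) h1
    rwa [Submodule.submoduleOf, Submodule.submoduleOf, Submodule.map_comap_subtype,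
      Submodule.map_comap_subtype, inf_eq_right.mpr (hle n), inf_eq_right.mpr (hle k)] at h2
  refine monotone_stabilizes_iff_artinian.mp fun f => ?_
  let L : ℕ → Submodule R H := fun i => OrderDual.ofDual (f i)
  have hL : Antitone L := fun i j hij => f.monotone hij
  -- The diagonal chain of layers stabilizes at some n and controls all layers of index at least n
  -- at once; the finitely many lower layers are stabilized separately.
  obtain ⟨n, hn⟩ := stab (fun k => (L k).socleLayer x k)
    (fun i j hij => ((L j).socleLayer_antitone x hij).trans (Submodule.socleLayer_mono x i (hL hij)))
    fun _ => inf_le_right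
  choose N hN using fun k : ℕ => stab (fun i => (L i).socleLayer x k)
    (fun i j hij => Submodule.socleLayer_mono x k (hL hij)) fun _ => inf_le_right
  let B := max n ((Finset.range n).sup N)
  refine ⟨B, fun i hi => ?_⟩
  have key : ∀ k, (L B).socleLayer x k ≤ (L i).socleLayer x k := by
    intro k
    by_cases hk : k < n
    · have h1 : N k ≤ B := (Finset.le_sup (Finset.mem_range.mpr hk)).trans (le_max_right _ _)
      exact ((hN k B h1).symm.trans (hN k i (h1.trans hi))).le
    · have hk : n ≤ k := by omega
      have hB : n ≤ B := le_max_left _ _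
      calc (L B).socleLayer x k ≤ (L B).socleLayer x n := (L B).socleLayer_antitone x hk
        _ ≤ (L n).socleLayer x n := Submodule.socleLayer_mono x n (hL hB)
        _ = (L (max i k)).socleLayer x (max i k) := hn _ (by omega)
        _ ≤ (L (max i k)).socleLayer x k := Submodule.socleLayer_antitone x _ (le_max_right _ _)
        _ ≤ (L i).socleLayer x k := Submodule.socleLayer_mono x k (hL (le_max_left _ _))
  exact show L B = L i from
    le_antisymm (Submodule.le_of_socleLayer_le hx (hL hi) key) (hL hi)

/-- Weak form of the existence of secondary representations. -/
lemma Submodule.exists_pow_smul_le_map_lsmul [IsNoetherianRing R] [IsArtinian R H] (𝔪 : Ideal R)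
    (L : Submodule R H) :
    ∃ (T : Set (Ideal R)) (n : ℕ), T.Finite ∧ (∀ P ∈ T, P.IsPrime ∧ P ≠ 𝔪) ∧
      ∀ x, (∀ P ∈ T, x ∉ P) → 𝔪 ^ n • L ≤ L.map (LinearMap.lsmul R H x) := by
  induction L using WellFoundedLT.induction with
  | ind L ih =>
    by_cases hsum : ∃ L₁ L₂, L₁ < L ∧ L₂ < L ∧ L₁ ⊔ L₂ = L
    · obtain ⟨L₁, L₂, h₁, h₂, rfl⟩ := hsum
      obtain ⟨T₁, n₁, hT₁, hp₁, hx₁⟩ := ih L₁ h₁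
      obtain ⟨T₂, n₂, hT₂, hp₂, hx₂⟩ := ih L₂ h₂
      refine ⟨T₁ ∪ T₂, max n₁ n₂, hT₁.union hT₂, fun P hP => hP.elim (hp₁ P) (hp₂ P),
        fun x hx => ?_⟩
      rw [Submodule.smul_sup, Submodule.map_sup]
      exact sup_le_sup
        ((Submodule.smul_mono_left (Ideal.pow_le_pow_right (le_max_left _ _))).trans
          (hx₁ x fun P hP => hx P (Or.inl hP)))
        ((Submodule.smul_mono_left (Ideal.pow_le_pow_right (le_max_right _ _))).trans
          (hx₂ x fun P hP => hx P (Or.inr hP)))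
    by_cases hL : L = ⊥
    · exact ⟨∅, 0, Set.finite_empty, by simp, by simp [hL]⟩
    have hmap : ∀ x : R, L.map (LinearMap.lsmul R H x) ≤ L := by
      rintro x _ ⟨l, hl, rfl⟩
      exact L.smul_mem x hl
    have hann : ∀ {x : R}, x ∈ L.annihilator ↔ L ≤ LinearMap.ker (LinearMap.lsmul R H x) := by
      intro x
      exact Submodule.mem_annihilator
    -- L is now not a sum of two proper submodules. A Fitting decomposition into the stable image of
    -- x^k and its kernel shows that x acts on L either nilpotently or surjectively.
    have hsurj : ∀ x ∉ L.annihilator.radical, L.map (LinearMap.lsmul R H x) = L := by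
      intro x hx
      have hpow : Antitone fun k => L.map (LinearMap.lsmul R H (x ^ k)) := by
        intro i j hij
        rintro _ ⟨l, hl, rfl⟩
        refine ⟨x ^ (j - i) • l, L.smul_mem _ hl, ?_⟩
        rw [LinearMap.lsmul_apply, LinearMap.lsmul_apply, ← mul_smul, ← pow_add,
          Nat.add_sub_cancel' hij]
      obtain ⟨k, hk⟩ := monotone_stabilizes_iff_artinian.mpr (inferInstanceAs (IsArtinian R H))
        ⟨fun k => OrderDual.toDual (L.map (LinearMap.lsmul R H (x ^ k))), hpow⟩
      have hk' : ∀ i, k ≤ i → L.map (LinearMap.lsmul R H (x ^ k)) =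
        L.map (LinearMap.lsmul R H (x ^ i)) := hk
      have hdec : L.map (LinearMap.lsmul R H (x ^ k)) ⊔
          (L ⊓ LinearMap.ker (LinearMap.lsmul R H (x ^ k))) = L := by
        refine le_antisymm (sup_le (hmap _) inf_le_left) fun l hl => ?_
        have h1 : x ^ k • l ∈ L.map (LinearMap.lsmul R H (x ^ (k + k))) := by
          rw [← hk' (k + k) (by omega)]
          exact ⟨l, hl, rfl⟩
        obtain ⟨l', hl', h2⟩ := h1
        rw [LinearMap.lsmul_apply, pow_add, mul_smul] at h2
        refine Submodule.mem_sup.mpr ⟨x ^ k • l', ⟨l', hl', rfl⟩, l - x ^ k • l',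
          ⟨L.sub_mem hl (L.smul_mem _ hl'), ?_⟩, by abel⟩
        rw [SetLike.mem_coe, LinearMap.mem_ker, LinearMap.lsmul_apply, smul_sub, h2, sub_self]
      have h3 : ¬ L ⊓ LinearMap.ker (LinearMap.lsmul R H (x ^ k)) = L := fun h =>
        hx ⟨k, hann.mpr (inf_eq_left.mp h)⟩
      have h4 : L.map (LinearMap.lsmul R H (x ^ k)) = L := by
        by_contra h
        exact hsum ⟨_, _, lt_of_le_of_ne (hmap _) h, lt_of_le_of_ne inf_le_left h3, hdec⟩
      refine le_antisymm (hmap x) ?_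
      calc L = L.map (LinearMap.lsmul R H (x ^ (k + 1))) := by
            rw [← hk' (k + 1) (by omega), h4]
        _ ≤ L.map (LinearMap.lsmul R H (x ^ 1)) := hpow (by omega)
        _ = L.map (LinearMap.lsmul R H x) := by rw [pow_one]
    -- A component attached to 𝔪 is killed by a power of 𝔪 and contributes only to n; any other
    -- component contributes its prime to T.
    by_cases hP : L.annihilator.radical = 𝔪
    · obtain ⟨n, hn⟩ := L.annihilator.exists_radical_pow_le_of_fg (IsNoetherian.noetherian _)
      refine ⟨∅, n, Set.finite_empty, by simp, fun x _ => ?_⟩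
      rw [← hP]
      refine (Submodule.smul_mono_left hn).trans ?_
      rw [Submodule.annihilator_smul]
      exact bot_le
    · refine ⟨{L.annihilator.radical}, 0, Set.finite_singleton _, ?_, fun x hx => ?_⟩
      · rintro _ rfl
        refine ⟨⟨?_, fun {x y} hxy => ?_⟩, hP⟩
        · rw [Ne, Ideal.radical_eq_top, Submodule.annihilator_eq_top_iff]
          exact hL
        · by_contra! h
          obtain ⟨k, hk⟩ := hxy
          have h1 : L.map (LinearMap.lsmul R H (x * y)) = L := by
            have : LinearMap.lsmul R H (x * y) = LinearMap.lsmul R H x ∘ₗ LinearMap.lsmul R H y := by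
              ext z; exact mul_smul x y z
            rw [this, Submodule.map_comp, hsurj y h.2, hsurj x h.1]
          have h2 : ∀ i : ℕ, L.map (LinearMap.lsmul R H ((x * y) ^ i)) = L := by
            intro i
            induction i with
            | zero =>
              have : LinearMap.lsmul R H ((x * y) ^ 0) = LinearMap.id := by ext z; simp
              rw [this, Submodule.map_id]
            | succ i hi =>
              have : LinearMap.lsmul R H ((x * y) ^ (i + 1)) =
                  LinearMap.lsmul R H ((x * y) ^ i) ∘ₗ LinearMap.lsmul R H (x * y) := by
                ext z; exact (congrArg (· • z) (pow_succ (x * y) i)).trans (mul_smul _ _ z)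
              rw [this, Submodule.map_comp, h1, hi]
          refine hL (eq_bot_iff.mpr ?_)
          conv_lhs => rw [← h2 k]
          rintro _ ⟨l, hl, rfl⟩
          exact (Submodule.mem_bot R).mpr (Submodule.mem_annihilator.mp hk l hl)
      · rw [pow_zero, Ideal.one_eq_top, Submodule.top_smul, hsurj x (hx _ rfl)]

/-- All powers of 𝔪 act onto H, so the components attached to 𝔪 are harmless; prime avoidance finds
x ∈ 𝔪 outside the finitely many other primes. -/
lemma exists_smul_surjective_of_smul_top_eq_top [IsNoetherianRing R] [IsArtinian R H]
    {𝔪 : Ideal R} [h𝔪 : 𝔪.IsMaximal] (hH : 𝔪 • (⊤ : Submodule R H) = ⊤) :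
    ∃ x ∈ 𝔪, Function.Surjective fun y : H => x • y := by
  obtain ⟨T, n, hT, hprime, hx⟩ :=
    Submodule.exists_pow_smul_le_map_lsmul 𝔪 (⊤ : Submodule R H)
  have hpow : 𝔪 ^ n • (⊤ : Submodule R H) = ⊤ := by
    clear hx
    induction n with
    | zero => rw [pow_zero, Ideal.one_eq_top, Submodule.top_smul]
    | succ n ih => rw [pow_succ, Submodule.mul_smul, hH, ih]
  have hnot : ¬ (𝔪 : Set R) ⊆ ⋃ P ∈ T, ((id P : Ideal R) : Set R) := by
    intro hsub
    obtain ⟨P, hP, hle⟩ := (Ideal.subset_union_prime_finite hT (f := id) ⊤ ⊤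
      fun P hP _ _ => (hprime P hP).1).mp hsub
    exact (hprime P hP).2 (h𝔪.eq_of_le (hprime P hP).1.ne_top hle).symm
  obtain ⟨x, hxm, hxT⟩ := Set.not_subset.mp hnot
  simp only [Set.mem_iUnion, not_exists, id] at hxT
  refine ⟨x, hxm, fun y => ?_⟩
  have h1 : y ∈ 𝔪 ^ n • (⊤ : Submodule R H) := by rw [hpow]; exact Submodule.mem_top
  obtain ⟨z, -, hz⟩ := hx x (fun P hP => hxT P hP) h1
  exact ⟨z, hz⟩

end Artinian

/-! ### Cohomological dimension, parameters and height -/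

section Height

variable {R : Type u} [CommRing R]

namespace LC

/-- The functor `H^i_𝔞` vanishes on all finite modules annihilated by `J`. -/
def VanishesOn (𝔞 J : Ideal R) (i : ℕ) : Prop :=
  ∀ (N : Type u) [AddCommGroup N] [Module R N] [Module.Finite R N],
    J ≤ Module.annihilator R N → Subsingleton (LC 𝔞 i (ModuleCat.of R N))

variable {𝔞 J : Ideal R} {i : ℕ}

lemma VanishesOn.mono (h : VanishesOn 𝔞 J i) {J' : Ideal R} (hJ : J ≤ J') : VanishesOn 𝔞 J' i :=
  fun N _ _ _ hN => h N (hJ.trans hN)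

lemma isArtinian_X₂ (𝔞 : Ideal R) {S : ShortComplex (ModuleCat.{u} R)} (hS : S.ShortExact) (i : ℕ)
    (h₁ : IsArtinian R (LC 𝔞 i S.X₁)) (h₃ : IsArtinian R (LC 𝔞 i S.X₃)) :
    IsArtinian R (LC 𝔞 i S.X₂) := by
  refine isArtinian_of_range_eq_ker (map 𝔞 i S.f) (map 𝔞 i S.g) (le_antisymm ?_ fun z hz => ?_)
  · rintro _ ⟨z, rfl⟩
    exact map_comp_eq_zero 𝔞 S i z
  · exact exact₂ 𝔞 hS i z hz

variable [IsNoetherianRing R]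

/-- The obstruction lies in H^(i+1) of the kernel, which is again finite and killed by J: where the
next degree vanishes, H^i is right exact. -/
lemma VanishesOn.map_surjective (h : VanishesOn 𝔞 J (i + 1)) {N N' : Type u} [AddCommGroup N]
    [Module R N] [AddCommGroup N'] [Module R N'] [Module.Finite R N]
    (hN : J ≤ Module.annihilator R N) (g : N →ₗ[R] N') (hg : Function.Surjective g) :
    Function.Surjective (map 𝔞 i (ModuleCat.ofHom g)) := by
  have hS : (ModuleCat.shortComplexOfCompEqZero (LinearMap.ker g).subtype g
      g.exact_subtype_ker_map.linearMap_comp_eq_zero).ShortExact :=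
    ModuleCat.shortComplex_shortExact _ g.exact_subtype_ker_map
      (Submodule.injective_subtype _) hg
  have : Module.Finite R (LinearMap.ker g) := inferInstance
  have h1 := h (LinearMap.ker g)
    (hN.trans ((LinearMap.ker g).subtype.annihilator_le_of_injective (Submodule.injective_subtype _)))
  exact fun z => exact₃ 𝔞 hS i z (h1.elim _ _)

/-- By prime filtrations only the modules R/q with J ≤ q matter, and right exactness makes H^i(R/q)
a quotient of H^i(R/J). -/
lemma VanishesOn.of_quotient (h : VanishesOn 𝔞 J (i + 1))
    (h' : Subsingleton (LC 𝔞 i (ModuleCat.of R (R ⧸ J)))) : VanishesOn 𝔞 J i := by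
  intro N _ _ _ hN
  refine Module.Finite.induction_of_le_annihilator J
    (P := fun N [AddCommGroup N] [Module R N] => Subsingleton (LC 𝔞 i (ModuleCat.of R N)))
    ?_ ?_ ?_ ?_ N hN
  · intro N _ _ _
    exact @subsingleton_of_subsingleton R _ 𝔞 i (ModuleCat.of R N) ‹_›
  · exact fun N N' _ _ _ _ e h => subsingleton_of_linearEquiv 𝔞 i e
  · intro N₁ N₂ N₃ _ _ _ _ _ _ f g hf hg hfg h₁ h₃
    have hS : (ModuleCat.shortComplexOfCompEqZero f g hfg.linearMap_comp_eq_zero).ShortExact :=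
      ModuleCat.shortComplex_shortExact _ hfg hf hg
    have h₁' : Subsingleton
      (LC 𝔞 i (ModuleCat.shortComplexOfCompEqZero f g hfg.linearMap_comp_eq_zero).X₁) := h₁
    have h₃' : Subsingleton
      (LC 𝔞 i (ModuleCat.shortComplexOfCompEqZero f g hfg.linearMap_comp_eq_zero).X₃) := h₃
    exact subsingleton₂ 𝔞 hS i
  · intro q _ hq
    exact (h.map_surjective (by rw [Ideal.annihilator_quotient]) (Submodule.factor hq)
      (Submodule.factor_surjective hq)).subsingleton

/-- The cohomological dimension of an ideal is attained at the ring. -/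
lemma vanishesOn_bot_of_subsingleton {j : ℕ}
    (h : ∀ i, j < i → Subsingleton (LC 𝔞 i (ModuleCat.of R R))) {i : ℕ} (hi : j < i) :
    VanishesOn 𝔞 ⊥ i := by
  obtain ⟨s, rfl⟩ := IsNoetherian.noetherian 𝔞
  -- Descending induction on i, starting above the number of generators, where everything vanishes.
  suffices ∀ d i, j < i → s.card < i + d → VanishesOn (Ideal.span (s : Set R)) ⊥ i from
    this (s.card + 1) i hi (by omega)
  intro d
  induction d with
  | zero => exact fun i _ hd N _ _ _ _ => subsingleton_span_of_card_lt s i hd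
  | succ d ih =>
    intro i hi hd
    have := h i hi
    exact (ih (i + 1) (by omega) (by omega)).of_quotient
      (subsingleton_of_linearEquiv _ i (Submodule.quotEquivOfEqBot (⊥ : Ideal R) rfl).symm)

/-- For cyclic S generated by the class of b ∈ 𝔟, the surjection R/J → S followed by the inclusion
is multiplication by b. Right exactness lifts classes along this surjection, and sums are handled by
S₁ × S₂ → S₁ + S₂. -/
lemma VanishesOn.range_map_subtype_le (h : VanishesOn 𝔞 J (i + 1)) (𝔟 : Ideal R)
    (S : Submodule R (R ⧸ J)) (hS : S ≤ Submodule.map J.mkQ 𝔟) :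
    LinearMap.range (map 𝔞 i (ModuleCat.ofHom S.subtype)) ≤ 𝔟 • ⊤ := by
  induction S, IsNoetherian.noetherian S using Submodule.fg_induction with
  | singleton y =>
    obtain ⟨b, hb, hby⟩ := hS (Submodule.mem_span_singleton_self y)
    let g : (R ⧸ J) →ₗ[R] Submodule.span R {y} :=
      (LinearMap.lsmul R (R ⧸ J) b).codRestrict _ fun c => by
        obtain ⟨c, rfl⟩ := Submodule.mkQ_surjective _ c
        refine Submodule.mem_span_singleton.mpr ⟨c, ?_⟩
        rw [← hby, LinearMap.lsmul_apply, ← map_smul, ← map_smul, smul_eq_mul, smul_eq_mul,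
          mul_comm]
    have hg : Function.Surjective g := by
      rintro ⟨z, hz⟩
      obtain ⟨c, rfl⟩ := Submodule.mem_span_singleton.mp hz
      refine ⟨J.mkQ c, Subtype.ext ?_⟩
      change b • J.mkQ c = c • y
      rw [← hby, ← map_smul, ← map_smul, smul_eq_mul, smul_eq_mul, mul_comm]
    rintro _ ⟨z, rfl⟩
    obtain ⟨w, rfl⟩ := h.map_surjective (by rw [Ideal.annihilator_quotient]) g hg z
    rw [map_map]
    have h1 : ModuleCat.ofHom g ≫ ModuleCat.ofHom (Submodule.span R {y}).subtype =
      b • 𝟙 (ModuleCat.of R (R ⧸ J)) := rfl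
    rw [h1, map_smul_id]
    exact Submodule.smul_mem_smul hb Submodule.mem_top
  | sup S₁ S₂ _ _ ih₁ ih₂ =>
    have hS₁ := ih₁ (le_sup_left.trans hS)
    have hS₂ := ih₂ (le_sup_right.trans hS)
    let g : (S₁ × S₂) →ₗ[R] (S₁ ⊔ S₂ : Submodule R (R ⧸ J)) :=
      (Submodule.inclusion le_sup_left).coprod (Submodule.inclusion le_sup_right)
    have hg : Function.Surjective g := by
      rintro ⟨z, hz⟩
      obtain ⟨z₁, h₁, z₂, h₂, rfl⟩ := Submodule.mem_sup.mp hz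
      exact ⟨(⟨z₁, h₁⟩, ⟨z₂, h₂⟩), rfl⟩
    have hann : J ≤ Module.annihilator R (S₁ × S₂) := fun r hr => by
      have hr' : ∀ c : R ⧸ J, r • c = 0 := by
        rw [← Module.mem_annihilator, Ideal.annihilator_quotient]
        exact hr
      exact Module.mem_annihilator.mpr fun c =>
        Prod.ext (Subtype.ext (hr' _)) (Subtype.ext (hr' _))
    rintro _ ⟨z, rfl⟩
    obtain ⟨w, rfl⟩ := h.map_surjective hann g hg z
    rw [map_map]
    have h1 : ModuleCat.ofHom g ≫ ModuleCat.ofHom (S₁ ⊔ S₂).subtype =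
      ModuleCat.ofHom (LinearMap.fst R S₁ S₂) ≫ ModuleCat.ofHom S₁.subtype +
        ModuleCat.ofHom (LinearMap.snd R S₁ S₂) ≫ ModuleCat.ofHom S₂.subtype := rfl
    rw [h1, map_add, ← map_map, ← map_map]
    exact Submodule.add_mem _ (hS₁ ⟨_, rfl⟩) (hS₂ ⟨_, rfl⟩)

/-- R/(J + 𝔞) is 𝔞-torsion and has no cohomology in the positive degree i + 1, so all classes come
from the image S of 𝔞 in R/J, and these lie in 𝔞 times the module. -/
lemma VanishesOn.smul_top_eq_top (h : VanishesOn 𝔞 J (i + 2)) :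
    𝔞 • (⊤ : Submodule R (LC 𝔞 (i + 1) (ModuleCat.of R (R ⧸ J)))) = ⊤ := by
  refine eq_top_iff.mpr fun z _ => ?_
  let S : Submodule R (R ⧸ J) := Submodule.map J.mkQ 𝔞
  have hS : powTorsion 𝔞 ((R ⧸ J) ⧸ S) = ⊤ := by
    refine powTorsion_eq_top_of_le_annihilator fun r hr => Module.mem_annihilator.mpr fun y => ?_
    obtain ⟨c, rfl⟩ := Submodule.mkQ_surjective _ y
    obtain ⟨c, rfl⟩ := Submodule.mkQ_surjective _ c
    rw [← map_smul]
    refine (Submodule.Quotient.mk_eq_zero _).mpr ⟨r • c, 𝔞.mul_mem_right c hr, map_smul _ _ _⟩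
  have h0 : Subsingleton (LC 𝔞 (i + 1) S.shortComplex.X₃) := subsingleton_of_powTorsion_eq_top hS i
  exact h.range_map_subtype_le 𝔞 S le_rfl
    (exact₂ 𝔞 S.shortExact_shortComplex (i + 1) z (h0.elim _ _))

/-- The local cohomology of a finite module with support in a maximal ideal is Artinian. -/
lemma isArtinian (𝔪 : Ideal R) [h𝔪 : 𝔪.IsMaximal] [IsLocalRing R] (N : Type u) [AddCommGroup N]
    [Module R N] [Module.Finite R N] : ∀ i, IsArtinian R (LC 𝔪 i (ModuleCat.of R N)) := by
  refine Module.Finite.induction_of_lt_annihilator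
    (P := fun N [AddCommGroup N] [Module R N] => ∀ i, IsArtinian R (LC 𝔪 i (ModuleCat.of R N)))
    ?_ ?_ ?_ ?_ N
  · intro N _ _ _ i
    have := @subsingleton_of_subsingleton R _ 𝔪 i (ModuleCat.of R N) ‹_›
    infer_instance
  · intro N N' _ _ _ _ e h i
    have := h i
    exact (mapEquiv 𝔪 i e.toModuleIso).isArtinian_iff.mp this
  · intro N₁ N₂ N₃ _ _ _ _ _ _ f g hf hg hfg h₁ h₃ i
    have hS : (ModuleCat.shortComplexOfCompEqZero f g hfg.linearMap_comp_eq_zero).ShortExact :=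
      ModuleCat.shortComplex_shortExact _ hfg hf hg
    exact isArtinian_X₂ 𝔪 hS i (h₁ i) (h₃ i)
  · intro q hq ih i
    by_cases hqm : q = 𝔪
    · subst hqm
      have htop : powTorsion q (R ⧸ q) = ⊤ :=
        powTorsion_eq_top_of_le_annihilator (by rw [Ideal.annihilator_quotient])
      obtain _ | i := i
      · have hsimple : IsSimpleModule R (R ⧸ q) := isSimpleModule_iff_isCoatom.mpr h𝔪.out
        have hfin : IsArtinian R (R ⧸ q) := inferInstance
        exact isArtinian_of_injective (ev q (ModuleCat.of R (R ⧸ q))) (ev_injective q _)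
      · have := subsingleton_of_powTorsion_eq_top htop i
        infer_instance
    obtain ⟨x, hxm, hxq⟩ := SetLike.exists_of_lt (lt_of_le_of_ne
      (IsLocalRing.eq_maximalIdeal h𝔪 ▸ IsLocalRing.le_maximalIdeal hq.ne_top) hqm)
    have hreg := Ideal.Quotient.isSMulRegular_of_notMem hxq
    have hC := ih _ (Ideal.Quotient.lt_annihilator_quotient_range_lsmul hxq)
    obtain _ | i := i
    · have := subsingleton_zero_of_isSMulRegular hxm hreg
      infer_instance
    · have := hC i
      -- The kernel of x lies in the image of H^i of the quotient of R/q by x, Artinian by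
      -- induction; the kernel criterion then applies.
      have hk : IsArtinian R (LinearMap.ker
          (LinearMap.lsmul R (LC 𝔪 (i + 1) (ModuleCat.of R (R ⧸ q))) x)) := by
        have hle : LinearMap.ker (LinearMap.lsmul R (LC 𝔪 (i + 1) (ModuleCat.of R (R ⧸ q))) x) ≤
            LinearMap.range (δ 𝔪 (shortExact_lsmul hreg) i) := fun z hz =>
          exact₁ 𝔪 (shortExact_lsmul hreg) i z ((map_lsmul 𝔪 (i + 1) x z).trans hz)
        have : IsArtinian R (LinearMap.range (δ 𝔪 (shortExact_lsmul hreg) i)) :=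
          isArtinian_of_surjective _ _ (LinearMap.surjective_rangeRestrict _)
        exact isArtinian_of_le hle
      exact isArtinian_of_isArtinian_ker_lsmul fun y => exists_pow_smul_eq_zero 𝔪 hxm y

end LC

variable [IsNoetherianRing R]

/-- This supplies nonvanishing: a nonzero finite module over a local ring has some nonzero local
cohomology at the maximal ideal. -/
lemma subsingleton_of_forall_subsingleton_LC [IsLocalRing R] {M : Type u} [AddCommGroup M]
    [Module R M] [Module.Finite R M]
    (h : ∀ i, Subsingleton (LC (IsLocalRing.maximalIdeal R) i (ModuleCat.of R M))) :
    Subsingleton M :=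
  subsingleton_of_ext_residueField
    (LC.ext_subsingleton_of_forall_subsingleton (by rw [Ideal.annihilator_quotient]) h)

open IsLocalRing in
/-- If local cohomology vanishes above degree `e` on modules killed by `J`, then `R ⧸ J` admits a
system of parameters with at most `e` elements. -/
lemma LC.VanishesOn.exists_finset [IsLocalRing R] (e : ℕ) {J : Ideal R}
    (h : ∀ i, e < i → VanishesOn (maximalIdeal R) J i) :
    ∃ s : Finset R, s.card ≤ e ∧ (s : Set R) ⊆ maximalIdeal R ∧
      maximalIdeal R ≤ (J ⊔ Ideal.span (s : Set R)).radical := by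
  classical
  induction e generalizing J with
  | zero =>
    refine ⟨∅, by simp, by simp, ?_⟩
    rw [Finset.coe_empty, Ideal.span_empty, sup_bot_eq, Ideal.radical_eq_sInf]
    refine le_sInf ?_
    rintro q ⟨hJq, hq⟩
    by_contra hne
    have hqm : q ≠ maximalIdeal R := fun h => hne h.ge
    obtain ⟨x, hxm, hxq⟩ := SetLike.exists_of_lt
      (lt_of_le_of_ne (IsLocalRing.le_maximalIdeal hq.ne_top) hqm)
    -- Positive degrees vanish by hypothesis, and degree 0 vanishes because x ∈ 𝔪 is regular on R/q.
    have hsub : Subsingleton (R ⧸ q) := subsingleton_of_forall_subsingleton_LC fun i => by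
      obtain _ | i := i
      · exact LC.subsingleton_zero_of_isSMulRegular hxm
          (Ideal.Quotient.isSMulRegular_of_notMem hxq)
      · exact h (i + 1) (by omega) (R ⧸ q) (by rwa [Ideal.annihilator_quotient])
    exact hq.ne_top (Ideal.Quotient.subsingleton_iff.mp hsub)
  | succ e ih =>
    have h1 := h (e + 2) (by omega)
    have := LC.isArtinian (maximalIdeal R) (R ⧸ J) (e + 1)
    obtain ⟨x, hxm, hx⟩ := exists_smul_surjective_of_smul_top_eq_top h1.smul_top_eq_top
    have hJ' : J ≤ J ⊔ Ideal.span {x} := le_sup_left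
    obtain ⟨s, hs, hsm, hrad⟩ := ih (J := J ⊔ Ideal.span {x}) fun i hi => by
      by_cases hi' : e + 1 < i
      · exact (h i hi').mono hJ'
      obtain rfl : i = e + 1 := by omega
      -- H^(e+1)(R/(J + (x))) is a quotient of H^(e+1)(R/J). There x acts surjectively, while it
      -- kills the target, so the target is zero.
      refine (h1.mono hJ').of_quotient (subsingleton_of_forall_eq 0 fun z => ?_)
      obtain ⟨w, rfl⟩ := h1.map_surjective (by rw [Ideal.annihilator_quotient])
        (Submodule.factor hJ') (Submodule.factor_surjective hJ') z
      obtain ⟨w, rfl⟩ := hx w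
      have hx0 : x • 𝟙 (ModuleCat.of R (R ⧸ (J ⊔ Ideal.span {x}))) = 0 := by
        refine ModuleCat.hom_ext (LinearMap.ext fun c => ?_)
        have : x ∈ Module.annihilator R (R ⧸ (J ⊔ Ideal.span {x})) := by
          rw [Ideal.annihilator_quotient]
          exact Ideal.mem_sup_right (Ideal.mem_span_singleton_self x)
        exact Module.mem_annihilator.mp this c
      refine (_root_.map_smul _ x w).trans ?_
      rw [← LC.map_smul_id, hx0, LC.map_zero]
    refine ⟨insert x s, (Finset.card_insert_le _ _).trans (by omega), ?_, ?_⟩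
    · rw [Finset.coe_insert]
      exact Set.insert_subset hxm hsm
    · rwa [Finset.coe_insert, Ideal.span_insert, ← sup_assoc]

open IsLocalRing in
/-- If the local cohomology of `R` with support in the maximal ideal is concentrated in one degree,
then this degree is the dimension of `R`. -/
lemma height_maximalIdeal_eq_of_concentrated [IsLocalRing R] (j : ℕ)
    (h : ∀ i, i ≠ j → Subsingleton (LC (maximalIdeal R) i (ModuleCat.of R R))) :
    (maximalIdeal R).height = j := by
  refine le_antisymm ?_ ?_
  · obtain ⟨s, hs, hsm, hrad⟩ := LC.VanishesOn.exists_finset j (J := (⊥ : Ideal R)) fun i hi =>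
      LC.vanishesOn_bot_of_subsingleton (fun i hi => h i (by omega)) hi
    rw [bot_sup_eq] at hrad
    have hmin : maximalIdeal R ∈ (Ideal.span (s : Set R)).minimalPrimes :=
      ⟨⟨inferInstance, Ideal.span_le.mpr hsm⟩, fun q hq _ => hrad.trans (hq.1.radical_le_iff.mpr hq.2)⟩
    exact (Ideal.height_le_card_of_mem_minimalPrimes_span_finset hmin).trans (by exact_mod_cast hs)
  -- If fewer than j elements generated 𝔪 up to radical, degree j would vanish as well, forcing R =
  -- 0.
  · by_contra! hlt
    obtain ⟨s, hs, hcard⟩ :=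
      (maximalIdeal R).exists_finset_card_eq_height_of_isNoetherianRing
    rw [← hcard] at hlt
    have hlt' : s.card < j := by exact_mod_cast hlt
    have hrad : maximalIdeal R ≤ (Ideal.span (s : Set R)).radical := by
      rw [Ideal.radical_eq_sInf]
      exact le_sInf fun q hq => hs.2 ⟨hq.2, hq.1⟩ (IsLocalRing.le_maximalIdeal hq.2.ne_top)
    have hsub : Subsingleton R := subsingleton_of_forall_subsingleton_LC fun i => by
      by_cases hi : i = j
      · subst hi
        exact (LC.subsingleton_congr_of_le_radical hs.1.2 hrad i).mp
          (LC.subsingleton_span_of_card_lt s i hlt')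
      · exact h i hi
    exact not_subsingleton R hsub

open IsLocalRing in
/-- If the local cohomology of `R` with support in `𝔞` is concentrated in one degree,
then this degree is the height of `𝔞`. -/
lemma height_eq_of_concentrated {𝔞 : Ideal R} (h𝔞 : 𝔞 ≠ ⊤) (j : ℕ)
    (h : ∀ i, i ≠ j → Subsingleton (LC 𝔞 i (ModuleCat.of R R))) : 𝔞.height = j := by
  -- At a minimal prime p the extension of 𝔞 has the maximal ideal as radical, and vanishing outside
  -- degree j survives. Nonvanishing in degree j is not needed: the localization is a nonzero ring.
  have key : ∀ p ∈ 𝔞.minimalPrimes, p.height = j := by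
    intro p hp
    have hprime : p.IsPrime := hp.1.1
    let A := Localization p.primeCompl
    have hloc : IsLocalRing A := IsLocalization.AtPrime.isLocalRing A p
    have hnoeth : IsNoetherianRing A := IsLocalization.isNoetherianRing p.primeCompl A inferInstance
    have hrad : (𝔞.map (algebraMap R A)).radical = maximalIdeal A := by
      rw [IsLocalization.AtPrime.radical_map_of_mem_minimalPrimes A p 𝔞 hp,
        IsLocalization.AtPrime.map_eq_maximalIdeal p A]
    have h1 : (maximalIdeal A).height = j :=
      height_maximalIdeal_eq_of_concentrated j fun i hi => by
        have h2 := LC.subsingleton_localizedModule p.primeCompl i (h i hi)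
        let e : LocalizedModule p.primeCompl R ≃ₗ[A] A :=
          (IsLocalizedModule.iso p.primeCompl (Algebra.linearMap R A)).extendScalarsOfIsLocalization
            p.primeCompl A
        have h3 := LC.subsingleton_of_linearEquiv (𝔞.map (algebraMap R A)) i e
        exact (LC.subsingleton_congr_of_le_radical (hrad ▸ Ideal.le_radical) hrad.ge i).mp h3
    have h4 := IsLocalization.AtPrime.ringKrullDim_eq_height p A
    rw [← IsLocalRing.maximalIdeal_height_eq_ringKrullDim, h1] at h4
    exact_mod_cast h4.symm
  obtain ⟨p, hp⟩ := Ideal.nonempty_minimalPrimes h𝔞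
  rw [Ideal.height_eq_inf_minimalPrimes]
  refine le_antisymm ((iInf₂_le p hp).trans (key p hp).le) (le_iInf₂ fun q hq => (key q hq).ge)

end Height

/-! ### Assembly of the equivalence -/

section MainResult

variable {R : Type u} [CommRing R]

lemma HasFiniteInjDim.iff_exists {M : ModuleCat.{u} R} :
    HasFiniteInjDim M ↔ ∃ n, HasInjectiveDimensionLT M (n + 1) := by
  rw [HasFiniteInjDim, lt_top_iff_ne_top, injectiveDimension_ne_top_iff]

lemma HasFiniteInjDim.congr {M N : ModuleCat.{u} R} (e : M ≅ N) :
    HasFiniteInjDim M ↔ HasFiniteInjDim N := by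
  rw [HasFiniteInjDim, HasFiniteInjDim, injectiveDimension_eq_of_iso e]

lemma IsRelativeCohenMacaulay.exists_concentrated {𝔞 : Ideal R}
    (h : IsRelativeCohenMacaulay 𝔞 R) :
    ∃ j, ∀ i, i ≠ j → Subsingleton (LC 𝔞 i (ModuleCat.of R R)) := by
  obtain ⟨j, -, hj⟩ := h.existsUnique_nontrivial
  refine ⟨j, fun i hi => ?_⟩
  have h1 := (not_nontrivial_iff_subsingleton.mp (mt (hj i) hi))
  exact (localCohomologyIsoLC 𝔞 i (ModuleCat.of R R)).toLinearEquiv.symm.toEquiv.subsingleton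

variable [IsNoetherianRing R]

lemma RingTheory.Sequence.IsRegular.subsingleton_LC {n : ℕ} {x : Fin n → R}
    (h : RingTheory.Sequence.IsRegular R (List.ofFn x)) {i : ℕ} (hi : i ≠ n) :
    Subsingleton (LC (Ideal.span (Set.range x)) i (ModuleCat.of R R)) := by
  classical
  obtain hlt | hgt := lt_or_gt_of_ne hi
  · refine LC.subsingleton_of_isWeaklyRegular (List.ofFn x) (fun r hr => ?_) h.toIsWeaklyRegular i
      (by rwa [List.length_ofFn])
    obtain ⟨k, rfl⟩ := (List.mem_ofFn' x r).mp hr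
    exact Ideal.subset_span ⟨k, rfl⟩
  · have hs : ((Finset.univ.image x : Finset R) : Set R) = Set.range x := by simp
    rw [← hs]
    refine LC.subsingleton_span_of_card_lt _ i (lt_of_le_of_lt Finset.card_image_le ?_)
    simpa using hgt

variable [IsLocalRing R]

lemma isGorensteinLocalRing_iff_of_concentrated {𝔞 : Ideal R} (h𝔞 : 𝔞 ≠ ⊤) (j : ℕ)
    (h : ∀ i, i ≠ j → Subsingleton (LC 𝔞 i (ModuleCat.of R R))) :
    IsGorensteinLocalRing R ↔
      HasFiniteInjDim ((localCohomology 𝔞 j).obj (ModuleCat.of R R)) := by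
  rw [HasFiniteInjDim.congr (localCohomologyIsoLC 𝔞 j _), HasFiniteInjDim.iff_exists]
  constructor
  · rintro ⟨-, -, hR⟩
    obtain ⟨n, hn⟩ := HasFiniteInjDim.iff_exists.mp hR
    exact ⟨n, LC.hasInjectiveDimensionLT_of_concentrated 𝔞 j n hn h⟩
  · rintro ⟨n, hn⟩
    -- Ext^q(k, H^j(R)) vanishes from q = n + 1 on, and the j dimension shifts move this threshold
    -- to n + 1 + j.
    refine ⟨inferInstance, inferInstance, HasFiniteInjDim.iff_exists.mpr ⟨n + 1 + j, ?_⟩⟩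
    refine ModuleCat.hasInjectiveDimensionLT_of_ext_residueField (n + 1 + j) fun p hp => ?_
    refine LC.ext_subsingleton_of_concentrated
      (by rw [Ideal.annihilator_quotient]; exact IsLocalRing.le_maximalIdeal h𝔞) j (n + 1) h
      (fun q hq => ?_) p hp
    exact subsingleton_of_forall_eq 0 fun x =>
      Abelian.Ext.eq_zero_of_hasInjectiveDimensionLT x (n + 1) hq

end MainResult

theorem corollary2p7 {R : Type u} [CommRing R] [IsNoetherianRing R] [IsLocalRing R] :
    (∀ 𝔞 : Ideal R, 𝔞 ≠ ⊤ → IsRelativeCohenMacaulay 𝔞 R →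
      -- `𝔞.height` is a natural number, as `𝔞` is a proper ideal of a Noetherian ring
      (IsGorensteinLocalRing R ↔
        HasFiniteInjDim ((localCohomology 𝔞 𝔞.height.toNat).obj (ModuleCat.of R R)))) ∧
    (∀ (n : ℕ) (x : Fin n → R), RingTheory.Sequence.IsRegular R (List.ofFn x) →
      (IsGorensteinLocalRing R ↔
        HasFiniteInjDim
          ((localCohomology (Ideal.span (Set.range x)) n).obj (ModuleCat.of R R)))) := by
  refine ⟨fun 𝔞 h𝔞 hCM => ?_, fun n x hx => ?_⟩
  · obtain ⟨j, hj⟩ := hCM.exists_concentrated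
    rw [height_eq_of_concentrated h𝔞 j hj, ENat.toNat_natCast]
    exact isGorensteinLocalRing_iff_of_concentrated h𝔞 j hj
  -- Were the span equal to `⊤`, it would multiply R onto itself, which regularity excludes.
  · refine isGorensteinLocalRing_iff_of_concentrated (fun htop => hx.top_ne_smul ?_) n
      fun i hi => hx.subsingleton_LC hi
    have : Ideal.ofList (List.ofFn x) = Ideal.span (Set.range x) :=
      congrArg Ideal.span (Set.ext fun r => List.mem_ofFn' x r)
    rw [this, htop, Submodule.top_smul]
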